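/- Let $T$ be a conservative, ergodic, measure preserving (not necessarily invertible) transformation of a $\sigma$-finite measure space $(X,\mathcal B,m)$, with transfer operator $\widehat T$ (so that $\int \widehat Tf\cdot g\,dm=\int f\cdot (g\circ T)\,dm$). Write $L^1_+(m)=\{f\in L^1(m): f\ge 0,\ m(f)>0\}$, where $m(f)=\int_X f\,dm$, and $\mathcal F=\{A\in\mathcal B: 0<m(A)<\infty\}$. Call $(a_n)_{n\ge1}$, $a_n>0$, a return sequence of $T$ if for every $f\in L^1_+(m)$ one has $\frac1{a_n}\sum_{k=0}^{n-1}\widehat T^kf\to m(f)$ in $\nu$-measure for every finite measure $\nu\ll m$, and $\limsup_{n\to\infty}\frac1{a_n}\sum_{k=0}^{n-1}\widehat T^kf=m(f)$ $m$-a.e. Suppose that $T$ is weakly pointwise dual ergodic, i.e. that $T$ has a return sequence. For $A\in\mathcal F$ put $L_A(n)=m(\bigcup_{k=0}^nT^{-k}A)$, $\varphi_A(x)=\min\{n\ge1:T^nx\in A\}$ and $c_A(\lambda)=\int_A(1-e^{-\lambda\varphi_A})\,dm$. The set $A\in\mathcal F$ has minimal wandering rate if $L_B(n)\sim L_A(n)$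 as $n\to\infty$ for all $B\in\mathcal F$ with $B\subseteq A$. It is uniform if there are $f\in L^1_+(m)$ and constants $a_n>0$ such that $\left|\frac1{a_n}\sum_{k=0}^{n-1}\widehat T^kf-m(f)\right|\to0$ in essential supremum on $A$. Then $T$ has a return sequence of the form $a_n=\sum_{j=0}^{n-1}u_j$ with all $u_j\ge0$, and: (i) for every such $(u_n)_{n\ge 0}$ and every $A\in\mathcal F$ of minimal wandering rate, the series $u_T(\lambda)=\sum_{n\ge0}e^{-\lambda n}u_n$ converges for all $\lambda>0$, and $$c_A(\lambda)\sim\frac1{u_T(\lambda)}\qquad\text{as }\lambda\to0^+;$$ (ii) every uniform set has minimal wandering rate (no regular variation of the return sequence is assumed). -/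

import Mathlib

open MeasureTheory Filter Topology Asymptotics

noncomputable section

namespace InfErg

variable {X : Type*} [MeasurableSpace X]

/-- The transfer operator of `T` with respect to `m`, on nonnegative measurable functions:
`transfer T m f` is the density with respect to `m` of the image under `T` of the measure
`f dm`, so that `∫ (transfer T m f) * g dm = ∫ f * (g ∘ T) dm`. -/
def transfer (T : X → X) (m : Measure X) (f : X → ENNReal) : X → ENNReal :=
  ((m.withDensity f).map T).rnDeriv m

/-- The class of nonnegative integrable functions with positive integral. -/
def L1Pos (m : Measure X) (f : X → ℝ) : Prop :=
  Integrable f m ∧ 0 ≤ᵐ[m] f ∧ 0 < ∫ x, f x ∂m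

/-- For `f` in `L1Pos m`, the sum of the iterates of the transfer operator on `f` from `0`
to `n - 1`; each iterate is integrable, hence finite almost everywhere. -/
def dualSum (T : X → X) (m : Measure X) (f : X → ℝ) (n : ℕ) (x : X) : ℝ :=
  ∑ k ∈ Finset.range n, ((transfer T m)^[k] (fun y => ENNReal.ofReal (f y)) x).toReal

/-- Measurable sets of positive finite measure. -/
def FinPos (m : Measure X) (A : Set X) : Prop :=
  MeasurableSet A ∧ 0 < m A ∧ m A < ⊤

/-- `a` (at indices `n ≥ 1`) is a sequence of positive constants as in the definition of
weak pointwise dual ergodicity: the normalized dual sums converge to the integral in measure,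
for every finite measure absolutely continuous with respect to `m`, and their upper limit
(in the extended reals) equals the integral almost everywhere. -/
def IsReturnSequence (T : X → X) (m : Measure X) (a : ℕ → ℝ) : Prop :=
  (∀ n, 1 ≤ n → 0 < a n) ∧
  (∀ f : X → ℝ, L1Pos m f → ∀ ν : Measure X, IsFiniteMeasure ν → ν ≪ m →
    TendstoInMeasure ν (fun n x => dualSum T m f n x / a n) atTop (fun _ => ∫ x, f x ∂m)) ∧
  (∀ f : X → ℝ, L1Pos m f → ∀ᵐ x ∂m,
    limsup (fun n => ((dualSum T m f n x / a n : ℝ) : EReal)) atTop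
      = ((∫ y, f y ∂m : ℝ) : EReal))

/-- Weak pointwise dual ergodicity. -/
def WeaklyPDE (T : X → X) (m : Measure X) : Prop :=
  ∃ a : ℕ → ℝ, IsReturnSequence T m a

/-- Uniform sets: the normalized dual sums of some `f` in `L1Pos m` converge to the integral
of `f` in the essential supremum norm on `A`. -/
def IsUniformSet (T : X → X) (m : Measure X) (A : Set X) : Prop :=
  FinPos m A ∧ ∃ f : X → ℝ, L1Pos m f ∧ ∃ a : ℕ → ℝ, (∀ n, 1 ≤ n → 0 < a n) ∧
    ∀ ε : ℝ, 0 < ε → ∀ᶠ n in atTop, ∀ᵐ x ∂(m.restrict A),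
      |dualSum T m f n x / a n - ∫ y, f y ∂m| ≤ ε

/-- The wandering rate `n ↦ m (⋃ k ≤ n, T⁻ᵏ A)`. -/
def wanderingRate (T : X → X) (m : Measure X) (A : Set X) (n : ℕ) : ℝ :=
  (m (⋃ k ∈ Finset.range (n + 1), T^[k] ⁻¹' A)).toReal

/-- Sets of minimal wandering rate. -/
def HasMinimalWanderingRate (T : X → X) (m : Measure X) (A : Set X) : Prop :=
  FinPos m A ∧ ∀ B : Set X, FinPos m B → B ⊆ A →
    wanderingRate T m B ~[atTop] wanderingRate T m A

/-- The first return time to `A`. (Its value is `0` at points that never return to `A`; for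
conservative `T` these form a null subset of `A`.) -/
def returnTime (T : X → X) (A : Set X) (x : X) : ℕ :=
  sInf {n : ℕ | 1 ≤ n ∧ T^[n] x ∈ A}

/-- `c_A(s) = ∫_A (1 - exp(-s φ_A)) dm`, with `φ_A` the return time of `A`. -/
def returnLaplace (T : X → X) (m : Measure X) (A : Set X) (s : ℝ) : ℝ :=
  ∫ x in A, (1 - Real.exp (-s * (returnTime T A x : ℝ))) ∂m

/-- The Laplace transform `u(s) = ∑ n, exp(-s n) u n`. -/
def laplaceSum (u : ℕ → ℝ) (s : ℝ) : ℝ :=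
  ∑' n : ℕ, Real.exp (-s * (n : ℝ)) * u n

end InfErg

end

/-! ### Abelian estimates for power series as z tends to 1 from below -/

noncomputable section

namespace InfErg

/-! Put z = exp(-λ) and q_n = m(A ∩ {φ_A > n}). Splitting the orbit of a point at its last visit to
A before time n gives the renewal equation `lintegral_resolvent_mul`: the resolvent Σ z^k T̂^k f,
integrated against Σ z^n 1_{A ∩ {φ_A > n}}, equals Σ z^n ∫ f over the set of points that hit A by
time n. Almost every orbit hits A, so the right side times 1 - z tends to m(f). Only values of the
resolvent on A matter. If there it is uniformly close to m(f) u(z), with u(z) = (1 - z) Σ z^n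
a_{n+1}, then u(z) (1 - z) Σ z^n q_n → 1 (`tendsto_mul_powSum_returnTail`). Here (1 - z) Σ z^n q_n
is c_A(λ), and u(z) is u_T(λ) when a_n = Σ_{j<n} u_j.

For (i) no uniformity is given, and it is manufactured along subsequences. The limsup condition
bounds the normalized dual sums on a subset of A of positive measure, so there convergence in
measure becomes convergence in mean. This passes to the resolvents, which are weighted averages of
dual sums. Along a subsequence of any z_k → 1 the convergence is then almost everywhere, and by
Egorov uniform on some B ⊆ A. The set B depends on the sequence, but minimal wandering rate makes
the transforms for B and A equivalent, so the limit holds for A.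

For (ii), uniformity on A is inherited by every B ⊆ A, with the same u(z). Hence the transforms of
L_B and L_A are equivalent. Wandering rates are partial sums of nonincreasing sequences, and L_B ≤
L_A; this concavity and ordering allow the Tauberian step `isEquivalent_partialSum_of_powSum`
without regular variation.

A return sequence is asymptotically nondecreasing, since dual sums increase with n, so its running
maxima form an equivalent sequence with nonnegative increments. -/

/-- The power series with coefficients `b`, as a function on `(0, 1)`. -/
def powSum (b : ℕ → ℝ) (z : ℝ) : ℝ := ∑' n, z ^ n * b n

lemma summable_pow_mul_of_linear {b : ℕ → ℝ} {C : ℝ}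
    (hb : ∀ᶠ n : ℕ in atTop, |b n| ≤ C * (n + 1)) {z : ℝ} (hz0 : 0 < z) (hz1 : z < 1) :
    Summable fun n => z ^ n * b n := by
  have h1 : Summable fun n : ℕ => ((n : ℝ) ^ 1 * z ^ n) :=
    summable_pow_mul_geometric_of_norm_lt_one 1 (by rw [Real.norm_of_nonneg hz0.le]; exact hz1)
  have h2 : Summable fun n : ℕ => z ^ n := summable_geometric_of_lt_one hz0.le hz1
  refine Summable.of_norm_bounded_eventually_nat ((h1.add h2).mul_left C) ?_
  filter_upwards [hb] with n hn
  have hzn : 0 < z ^ n := pow_pos hz0 n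
  rw [norm_mul, Real.norm_of_nonneg hzn.le, Real.norm_eq_abs]
  calc z ^ n * |b n| ≤ z ^ n * (C * (n + 1)) := by gcongr
    _ = _ := by ring

/-- Summation by parts: b_n is the difference of consecutive partial sums, and shifting the index
costs a factor z. -/
lemma hasSum_pow_mul_of_partialSum {b : ℕ → ℝ} {z : ℝ}
    (h : Summable fun n => z ^ n * ∑ k ∈ Finset.range (n + 1), b k) :
    HasSum (fun n => z ^ n * b n)
      ((1 - z) * powSum (fun n => ∑ k ∈ Finset.range (n + 1), b k) z) := by
  set s : ℕ → ℝ := fun n => ∑ k ∈ Finset.range (n + 1), b k with hs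
  have h1 : HasSum (fun n => z ^ n * s n) (powSum s z) := h.hasSum
  have h2 : HasSum (fun n => if n = 0 then 0 else z * (z ^ (n - 1) * s (n - 1)))
      (z * powSum s z) := by
    rw [← hasSum_nat_add_iff' 1]
    simpa using h1.mul_left z
  have h3 := h1.sub h2
  rw [show powSum s z - z * powSum s z = (1 - z) * powSum s z by ring] at h3
  convert! h3 using 2 with n
  rcases n with _ | n
  · simp [hs]
  · have : s (n + 1) = s n + b (n + 1) := Finset.sum_range_succ _ _
    simp only [Nat.add_one_ne_zero, if_false, Nat.add_sub_cancel, this]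
    ring

lemma powSum_eq_of_partialSum {b : ℕ → ℝ} {z : ℝ}
    (h : Summable fun n => z ^ n * ∑ k ∈ Finset.range (n + 1), b k) :
    powSum b z = (1 - z) * powSum (fun n => ∑ k ∈ Finset.range (n + 1), b k) z :=
  (hasSum_pow_mul_of_partialSum h).tsum_eq

lemma eventually_mem_Ioo_nhdsLT_one : ∀ᶠ z : ℝ in 𝓝[<] 1, 0 < z ∧ z < 1 :=
  Ioo_mem_nhdsLT zero_lt_one

lemma tendsto_powSum_atTop {a : ℕ → ℝ} (ha : ∀ n, 0 ≤ a n) (hna : ¬ Summable a)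
    (hs : ∀ z : ℝ, 0 < z → z < 1 → Summable fun n => z ^ n * a n) :
    Tendsto (powSum a) (𝓝[<] 1) atTop := by
  rw [not_summable_iff_tendsto_nat_atTop_of_nonneg ha] at hna
  rw [tendsto_atTop]
  intro K
  obtain ⟨M, hM⟩ := (hna.eventually_gt_atTop K).exists
  have hc : Tendsto (fun z : ℝ => ∑ n ∈ Finset.range M, z ^ n * a n) (𝓝[<] 1)
      (𝓝 (∑ n ∈ Finset.range M, (1 : ℝ) ^ n * a n)) := by
    have : Continuous fun z : ℝ => ∑ n ∈ Finset.range M, z ^ n * a n := by fun_prop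
    exact (this.tendsto 1).mono_left nhdsWithin_le_nhds
  simp only [one_pow, one_mul] at hc
  filter_upwards [hc.eventually (lt_mem_nhds hM), eventually_mem_Ioo_nhdsLT_one] with z hz hz01
  refine hz.le.trans ((hs z hz01.1 hz01.2).sum_le_tsum _ fun n _ => ?_)
  exact mul_nonneg (pow_nonneg hz01.1.le n) (ha n)

lemma powSum_nonneg {a : ℕ → ℝ} (ha : ∀ n, 0 ≤ a n) {z : ℝ} (hz : 0 ≤ z) : 0 ≤ powSum a z :=
  tsum_nonneg fun n => mul_nonneg (pow_nonneg hz n) (ha n)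

lemma abs_powSum_le {b : ℕ → ℝ} {z : ℝ} (hz : 0 ≤ z) (h : Summable fun n => z ^ n * |b n|) :
    |powSum b z| ≤ powSum (fun n => |b n|) z := by
  have : (fun n => ‖z ^ n * b n‖) = fun n => z ^ n * |b n| := by
    ext n
    rw [norm_mul, Real.norm_of_nonneg (pow_nonneg hz n), Real.norm_eq_abs]
  have h2 := norm_tsum_le_tsum_norm (f := fun n => z ^ n * b n) (by rwa [this])
  rwa [this] at h2

/-- The head costs at most `N * K` and the tail is dominated. The bound is kept explicit because it
is later needed uniformly over the points x of a set, with `N` and `K` independent of x. -/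
lemma abs_powSum_le_add {a b : ℕ → ℝ} {c K z : ℝ} {N : ℕ} (hc : 0 ≤ c) (ha : ∀ n, 0 ≤ a n)
    (hz0 : 0 < z) (hz1 : z < 1) (hs : Summable fun n => z ^ n * a n)
    (h1 : ∀ n, N ≤ n → |b n| ≤ c * a n) (h2 : ∀ n, n < N → |b n| ≤ K) :
    Summable (fun n => z ^ n * b n) ∧ |powSum b z| ≤ c * powSum a z + N * K := by
  set e : ℕ → ℝ := fun n => if n ∈ Finset.range N then K else 0 with he
  have hle : ∀ n, z ^ n * |b n| ≤ c * (z ^ n * a n) + e n := by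
    intro n
    have hzn := pow_nonneg hz0.le n
    by_cases hn : n < N
    · have : z ^ n * |b n| ≤ 1 * K :=
        mul_le_mul (pow_le_one₀ hz0.le hz1.le) (h2 n hn) (abs_nonneg _) zero_le_one
      have h3 : 0 ≤ c * (z ^ n * a n) := by have := ha n; positivity
      simp only [he, Finset.mem_range, hn, if_true]
      linarith
    · simp only [he, Finset.mem_range, hn, if_false, add_zero]
      calc z ^ n * |b n| ≤ z ^ n * (c * a n) := by gcongr; exact h1 n (not_lt.1 hn)
        _ = _ := by ring
  have hes : HasSum e (N * K) := by
    have : ∑ n ∈ Finset.range N, e n = N * K := by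
      rw [Finset.sum_congr rfl fun n hn => if_pos hn]
      simp
    rw [← this]
    exact hasSum_sum_of_ne_finset_zero fun n hn => if_neg hn
  have hs1 := (hs.hasSum.mul_left c).add hes
  have hsb : Summable fun n => z ^ n * |b n| :=
    Summable.of_nonneg_of_le (fun n => by positivity) hle hs1.summable
  refine ⟨?_, (abs_powSum_le hz0.le hsb).trans (hasSum_le hle hsb.hasSum hs1)⟩
  refine hsb.of_norm_bounded fun n => ?_
  rw [norm_mul, Real.norm_of_nonneg (pow_nonneg hz0.le n), Real.norm_eq_abs]

lemma powSum_isLittleO {a b : ℕ → ℝ} (ha : ∀ n, 0 ≤ a n) (hna : ¬ Summable a)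
    (hs : ∀ z : ℝ, 0 < z → z < 1 → Summable fun n => z ^ n * a n) (hb : b =o[atTop] a) :
    powSum b =o[𝓝[<] 1] powSum a := by
  rw [isLittleO_iff] at hb ⊢
  intro c hc
  obtain ⟨N, hN⟩ := eventually_atTop.1 (hb (half_pos hc))
  set K : ℝ := ∑ n ∈ Finset.range N, |b n| with hK
  filter_upwards [(tendsto_powSum_atTop ha hna hs).eventually_ge_atTop (N * K / (c / 2)),
    eventually_mem_Ioo_nhdsLT_one] with z hz ⟨hz0, hz1⟩
  have hKz : N * K ≤ c / 2 * powSum a z := by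
    rwa [div_le_iff₀' (half_pos hc)] at hz
  have h := (abs_powSum_le_add (b := b) (half_pos hc).le ha hz0 hz1 (hs z hz0 hz1)
    (fun n hn => by simpa [abs_of_nonneg (ha n)] using hN n hn)
    (fun n hn => Finset.single_le_sum (f := fun n => |b n|) (fun _ _ => abs_nonneg _)
      (Finset.mem_range.2 hn))).2
  rw [Real.norm_eq_abs, Real.norm_of_nonneg (powSum_nonneg ha hz0.le)]
  linarith

lemma powSum_one {z : ℝ} (hz0 : 0 < z) (hz1 : z < 1) : powSum (fun _ => 1) z = (1 - z)⁻¹ := by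
  simpa [powSum] using tsum_geometric_of_lt_one hz0.le hz1

lemma powSum_add {a b : ℕ → ℝ} {z : ℝ} (ha : Summable fun n => z ^ n * a n)
    (hb : Summable fun n => z ^ n * b n) :
    powSum (fun n => a n + b n) z = powSum a z + powSum b z := by
  simp only [powSum, mul_add]
  exact ha.tsum_add hb

lemma powSum_const_mul (c : ℝ) (a : ℕ → ℝ) (z : ℝ) :
    powSum (fun n => c * a n) z = c * powSum a z := by
  simp only [powSum, mul_left_comm _ c]
  exact tsum_mul_left

lemma powSum_sub {a b : ℕ → ℝ} {z : ℝ} (ha : Summable fun n => z ^ n * a n)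
    (hb : Summable fun n => z ^ n * b n) :
    powSum (fun n => a n - b n) z = powSum a z - powSum b z := by
  simp only [powSum, mul_sub]
  exact ha.tsum_sub hb

lemma tendsto_one_sub_mul_powSum {b : ℕ → ℝ} {β : ℝ} (hb : Tendsto b atTop (𝓝 β)) :
    Tendsto (fun z => (1 - z) * powSum b z) (𝓝[<] 1) (𝓝 β) := by
  have hs1 : ∀ z : ℝ, 0 < z → z < 1 → Summable fun n : ℕ => z ^ n * (1 : ℝ) := fun z h0 h1 => by
    simpa using summable_geometric_of_lt_one h0.le h1
  have ho : (fun n => b n - β) =o[atTop] fun _ => (1 : ℝ) := by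
    rw [isLittleO_one_iff]
    simpa using hb.sub_const β
  have hna : ¬ Summable fun _ : ℕ => (1 : ℝ) := by
    simp [summable_const_iff]
  have h := powSum_isLittleO (fun _ => zero_le_one) hna hs1 ho
  have h2 : Tendsto (fun z => powSum (fun n => b n - β) z / powSum (fun _ => 1) z) (𝓝[<] 1) (𝓝 0) :=
    h.tendsto_div_nhds_zero
  have h3 := h2.add_const β
  rw [zero_add] at h3
  refine h3.congr' ?_
  filter_upwards [eventually_mem_Ioo_nhdsLT_one] with z ⟨hz0, hz1⟩
  have hbs : Summable fun n => z ^ n * (b n - β) := by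
    refine summable_pow_mul_of_linear (C := 1) ?_ hz0 hz1
    filter_upwards [(isLittleO_one_iff ℝ).1 ho |>.abs |>.eventually_le_const
      (show |(0 : ℝ)| < 1 by simp)] with n hn
    have : (0 : ℝ) ≤ n := n.cast_nonneg
    linarith
  have hcs : Summable fun n => z ^ n * (β * 1) := by
    simpa only [mul_left_comm _ β] using (hs1 z hz0 hz1).mul_left β
  have : powSum b z = powSum (fun n => b n - β) z + β * powSum (fun _ => 1) z := by
    rw [← powSum_const_mul, ← powSum_add hbs hcs]
    simp
  have hz : 1 - z ≠ 0 := by linarith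
  rw [this, powSum_one hz0 hz1]
  field_simp

lemma powSum_isEquivalent {a b : ℕ → ℝ} (ha : ∀ n, 0 ≤ a n) (hna : ¬ Summable a)
    (hsa : ∀ z : ℝ, 0 < z → z < 1 → Summable fun n => z ^ n * a n)
    (hsb : ∀ z : ℝ, 0 < z → z < 1 → Summable fun n => z ^ n * b n) (h : b ~[atTop] a) :
    powSum b ~[𝓝[<] 1] powSum a := by
  refine (powSum_isLittleO ha hna hsa h.isLittleO).congr' ?_ EventuallyEq.rfl
  filter_upwards [eventually_mem_Ioo_nhdsLT_one] with z ⟨hz0, hz1⟩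
  exact powSum_sub (hsb z hz0 hz1) (hsa z hz0 hz1)

/-! ### A Tauberian theorem for concave sequences -/

section Tauberian

variable {p q : ℕ → ℝ}

lemma partialSum_add_le (hp : Antitone p) (n d : ℕ) :
    ∑ k ∈ Finset.range (n + d + 1), p k ≤ ∑ k ∈ Finset.range (n + 1), p k + d * p n := by
  induction d with
  | zero => simp
  | succ d ih =>
    rw [← add_assoc, Finset.sum_range_succ _ (n + d + 1)]
    have := hp (show n ≤ n + d + 1 by omega)
    push_cast
    linarith

lemma succ_mul_le_partialSum (hp : Antitone p) (n : ℕ) :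
    ((n : ℝ) + 1) * p n ≤ ∑ k ∈ Finset.range (n + 1), p k := by
  have := Finset.card_nsmul_le_sum (Finset.range (n + 1)) p (p n)
    fun k hk => hp (Nat.lt_succ_iff.1 (Finset.mem_range.1 hk))
  simpa using this

/-- Each later term is at most `p n`, which is at most the average of the terms up to n. This bound
on relative growth stands in for regular variation. -/
lemma partialSum_add_le_mul (hp : Antitone p) (n d : ℕ) :
    ∑ k ∈ Finset.range (n + d + 1), p k
      ≤ (1 + d / ((n : ℝ) + 1)) * ∑ k ∈ Finset.range (n + 1), p k := by
  have h1 := partialSum_add_le hp n d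
  have h2 := succ_mul_le_partialSum hp n
  have h3 : p n ≤ (∑ k ∈ Finset.range (n + 1), p k) / ((n : ℝ) + 1) := by
    rw [le_div_iff₀ (by positivity)]
    linarith
  have h4 : (d : ℝ) * p n ≤ d * ((∑ k ∈ Finset.range (n + 1), p k) / ((n : ℝ) + 1)) := by gcongr
  calc _ ≤ _ := h1
    _ ≤ _ := add_le_add_right h4 _
    _ = _ := by ring

lemma monotone_partialSum (hp0 : ∀ n, 0 ≤ p n) :
    Monotone fun n => ∑ k ∈ Finset.range (n + 1), p k :=
  monotone_nat_of_le_succ fun n => by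
    rw [Finset.sum_range_succ _ (n + 1)]
    linarith [hp0 (n + 1)]

/-- Concavity gives P_k ≤ (1 + k/n) P_n for all k. With 1 - z = 1/(4n) the two geometric series
contribute at most 4n P_n and 16n P_n. The factor 4 is what keeps z^k ≥ 1/2 up to k = 2n, by
Bernoulli. -/
lemma powSum_partialSum_le (hp : Antitone p) (hp0 : ∀ n, 0 ≤ p n) {n : ℕ} (hn : 1 ≤ n) :
    Summable (fun k => (1 - 1 / (4 * (n : ℝ))) ^ k * ∑ i ∈ Finset.range (k + 1), p i) ∧
    powSum (fun k => ∑ i ∈ Finset.range (k + 1), p i) (1 - 1 / (4 * (n : ℝ)))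
      ≤ 20 * n * ∑ k ∈ Finset.range (n + 1), p k := by
  set P : ℕ → ℝ := fun n => ∑ k ∈ Finset.range (n + 1), p k with hP
  have hn' : (1 : ℝ) ≤ n := by exact_mod_cast hn
  set z : ℝ := 1 - 1 / (4 * (n : ℝ)) with hz
  have hz0 : 0 < z := by
    rw [hz, sub_pos, div_lt_one (by positivity)]
    linarith
  have hz1 : z < 1 := by
    rw [hz]
    have : 0 < 1 / (4 * (n : ℝ)) := by positivity
    linarith
  have hP0 : ∀ n, 0 ≤ P n := fun n => Finset.sum_nonneg fun k _ => hp0 k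
  have hmono : Monotone P := monotone_partialSum hp0
  have hle : ∀ k, P k ≤ (1 + k / (n : ℝ)) * P n := by
    intro k
    rcases le_total k n with h | h
    · have h1 := hmono h
      have h2 : 0 ≤ (k : ℝ) / n * P n := mul_nonneg (by positivity) (hP0 n)
      linarith
    · obtain ⟨d, rfl⟩ := Nat.exists_eq_add_of_le h
      refine (partialSum_add_le_mul hp n d).trans ?_
      refine mul_le_mul_of_nonneg_right ?_ (hP0 n)
      gcongr
      · linarith
      · linarith
  have hg : HasSum (fun k : ℕ => z ^ k) (1 - z)⁻¹ := hasSum_geometric_of_lt_one hz0.le hz1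
  have hg' : HasSum (fun k : ℕ => (k : ℝ) * z ^ k) (z / (1 - z) ^ 2) :=
    hasSum_coe_mul_geometric_of_norm_lt_one (by rw [Real.norm_of_nonneg hz0.le]; exact hz1)
  have hsum := (hg.mul_right (P n)).add (hg'.mul_right (P n / n))
  have hle' : ∀ k, z ^ k * P k ≤ z ^ k * P n + k * z ^ k * (P n / n) := fun k => by
    calc z ^ k * P k ≤ z ^ k * ((1 + k / (n : ℝ)) * P n) := by gcongr; exact hle k
      _ = _ := by ring
  have hsP : Summable fun k => z ^ k * P k := Summable.of_nonneg_of_le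
    (fun k => mul_nonneg (pow_nonneg hz0.le k) (hP0 k)) hle' hsum.summable
  refine ⟨hsP, (hasSum_le hle' hsP.hasSum hsum).trans ?_⟩
  have h1z : 1 - z = (4 * (n : ℝ))⁻¹ := by rw [hz]; ring
  rw [h1z]
  have : z / (4 * (n : ℝ))⁻¹ ^ 2 * (P n / n) ≤ 1 / (4 * (n : ℝ))⁻¹ ^ 2 * (P n / n) := by
    have := hP0 n
    gcongr
  refine (add_le_add_right this _).trans (le_of_eq ?_)
  field_simp
  ring

lemma half_le_pow_of_le_two_mul {n k : ℕ} (hn : 1 ≤ n) (hk : k ≤ 2 * n) :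
    1 / 2 ≤ (1 - 1 / (4 * (n : ℝ))) ^ k := by
  have hn' : (1 : ℝ) ≤ n := by exact_mod_cast hn
  have hk' : (k : ℝ) ≤ 2 * n := by exact_mod_cast hk
  have h1 : 1 / (4 * (n : ℝ)) ≤ 1 := by
    rw [div_le_one (by positivity)]; linarith
  have h := one_add_mul_le_pow (a := -(1 / (4 * (n : ℝ)))) (by linarith) k
  have h2 : (k : ℝ) * (1 / (4 * n)) ≤ 1 / 2 := by
    rw [mul_one_div, div_le_iff₀ (by positivity)]
    linarith
  rw [sub_eq_add_neg]
  linarith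

/-- A Tauberian theorem for partial sums of nonincreasing sequences. -/
lemma isEquivalent_partialSum_of_powSum (hp : Antitone p) (hq : Antitone q) (hp0 : ∀ n, 0 ≤ p n)
    (hq0 : ∀ n, 0 ≤ q n)
    (hle : ∀ n, ∑ k ∈ Finset.range (n + 1), q k ≤ ∑ k ∈ Finset.range (n + 1), p k)
    (h : powSum (fun n => ∑ k ∈ Finset.range (n + 1), q k)
      ~[𝓝[<] 1] powSum (fun n => ∑ k ∈ Finset.range (n + 1), p k)) :
    (fun n => ∑ k ∈ Finset.range (n + 1), q k) ~[atTop]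
      fun n => ∑ k ∈ Finset.range (n + 1), p k := by
  set P : ℕ → ℝ := fun n => ∑ k ∈ Finset.range (n + 1), p k with hP
  set Q : ℕ → ℝ := fun n => ∑ k ∈ Finset.range (n + 1), q k with hQ
  have hP0 : ∀ n, 0 ≤ P n := fun n => Finset.sum_nonneg fun k _ => hp0 k
  have hQ0 : ∀ n, 0 ≤ Q n := fun n => Finset.sum_nonneg fun k _ => hq0 k
  have hPm : Monotone P := monotone_partialSum hp0
  rw [IsEquivalent, isLittleO_iff]
  intro c hc
  set ε : ℝ := min (c / 2) 1 with hε
  have hε0 : 0 < ε := lt_min (half_pos hc) one_pos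
  have hε1 : ε ≤ 1 := min_le_right _ _
  have hεc : 2 * ε ≤ c := by linarith [min_le_left (c / 2) (1 : ℝ)]
  -- Chosen so that (ε²/40) · 20 n P_n = (ε n / 2) · ε P_n, to be compared with the contribution of
  -- a window of about ε n indices.
  have hη : 0 < ε ^ 2 / 40 := by positivity
  have hzt : Tendsto (fun n : ℕ => 1 - 1 / (4 * (n : ℝ))) atTop (𝓝[<] 1) := by
    refine tendsto_nhdsWithin_iff.2 ⟨?_, ?_⟩
    · have : Tendsto (fun n : ℕ => (4 * (n : ℝ))) atTop atTop :=
        tendsto_natCast_atTop_atTop.const_mul_atTop (by norm_num)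
      simpa using this.inv_tendsto_atTop.const_sub 1
    · filter_upwards [eventually_ge_atTop 1] with n hn
      have hn' : (1 : ℝ) ≤ n := by exact_mod_cast hn
      have : 0 < 1 / (4 * (n : ℝ)) := by positivity
      simp only [Set.mem_Iio]
      linarith
  filter_upwards [hzt.eventually ((isLittleO_iff.1 h.isLittleO) hη), eventually_ge_atTop 1,
    hzt.eventually eventually_mem_Ioo_nhdsLT_one] with n hn hn1 hz01
  set z : ℝ := 1 - 1 / (4 * (n : ℝ)) with hz
  obtain ⟨hz0, hz1⟩ := hz01
  have hn' : (1 : ℝ) ≤ n := by exact_mod_cast hn1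
  obtain ⟨hsP, hPb⟩ := powSum_partialSum_le hp hp0 hn1
  obtain ⟨hsQ, -⟩ := powSum_partialSum_le hq hq0 hn1
  rw [Pi.sub_apply, norm_sub_rev, ← powSum_sub hsP hsQ] at hn
  have hD0 : ∀ n, 0 ≤ P n - Q n := fun n => sub_nonneg.2 (hle n)
  have hsD : Summable fun k => z ^ k * (P k - Q k) := by
    simpa only [mul_sub] using hsP.sub hsQ
  rw [Real.norm_of_nonneg (powSum_nonneg hD0 hz0.le),
    Real.norm_of_nonneg (powSum_nonneg hP0 hz0.le)] at hn
  rw [Pi.sub_apply, Real.norm_eq_abs, abs_sub_comm, abs_of_nonneg (hD0 n),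
    Real.norm_of_nonneg (hP0 n)]
  rcases le_total (P n - Q n) (ε * P n) with hcase | hcase
  · have : ε * P n ≤ c * P n := mul_le_mul_of_nonneg_right (by linarith) (hP0 n)
    linarith
  -- A large gap at n persists: on [n, n + J] the sequence P does not decrease, while Q grows by at
  -- most ε Q_n ≤ ε P_n. Since ε ≤ 1 the window lies below 2n, where z^k ≥ 1/2, and it has J + 1 > ε
  -- n indices. Its contribution would exceed the bound on the transform of P - Q unless the gap is
  -- at most 2 ε P_n.
  set J : ℕ := ⌊ε * n⌋₊ with hJ
  have hJle : (J : ℝ) ≤ ε * n := Nat.floor_le (by positivity)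
  have hJn : J ≤ n := by
    have : (J : ℝ) ≤ n := by nlinarith
    exact_mod_cast this
  have hJlt : ε * n < J + 1 := Nat.lt_floor_add_one _
  have hwin : ∀ k ∈ Finset.Ico n (n + (J + 1)),
      1 / 2 * (P n - Q n - ε * P n) ≤ z ^ k * (P k - Q k) := by
    intro k hk
    rw [Finset.mem_Ico] at hk
    obtain ⟨d, rfl⟩ := Nat.exists_eq_add_of_le hk.1
    have hd : d ≤ J := by omega
    have hz2 : 1 / 2 ≤ z ^ (n + d) := half_le_pow_of_le_two_mul hn1 (by omega)
    have hQd : Q (n + d) ≤ (1 + d / ((n : ℝ) + 1)) * Q n := partialSum_add_le_mul hq n d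
    have hdε : (d : ℝ) / (n + 1) ≤ ε := by
      rw [div_le_iff₀ (by positivity)]
      have : (d : ℝ) ≤ J := by exact_mod_cast hd
      nlinarith
    have h1 : (d : ℝ) / (n + 1) * Q n ≤ ε * P n :=
      mul_le_mul hdε (hle n) (hQ0 n) hε0.le
    have h2 : P n - Q n - ε * P n ≤ P (n + d) - Q (n + d) := by
      have := hPm (Nat.le_add_right n d)
      linarith
    exact mul_le_mul hz2 h2 (by linarith) (by positivity)
  have hsum := Finset.card_nsmul_le_sum _ _ _ hwin
  rw [Nat.card_Ico, Nat.add_sub_cancel_left, nsmul_eq_mul] at hsum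
  have htot := hsD.sum_le_tsum (Finset.Ico n (n + (J + 1)))
    fun k _ => mul_nonneg (pow_nonneg hz0.le k) (hD0 k)
  have hfin : ε * n * (1 / 2 * (P n - Q n - ε * P n)) ≤ ε ^ 2 / 40 * (20 * n * P n) := by
    calc ε * n * (1 / 2 * (P n - Q n - ε * P n))
        ≤ ((J + 1 : ℕ) : ℝ) * (1 / 2 * (P n - Q n - ε * P n)) := by
          have : 0 ≤ 1 / 2 * (P n - Q n - ε * P n) := by linarith
          refine mul_le_mul_of_nonneg_right ?_ this
          push_cast
          exact hJlt.le
      _ ≤ powSum (fun k => P k - Q k) z := hsum.trans htot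
      _ ≤ ε ^ 2 / 40 * powSum P z := hn
      _ ≤ ε ^ 2 / 40 * (20 * n * P n) := by gcongr
  have hfin2 : P n - Q n - ε * P n ≤ ε * P n := by
    have hpos : 0 < ε * n / 2 := by positivity
    refine le_of_mul_le_mul_left ?_ hpos
    linarith
  have : 2 * ε * P n ≤ c * P n := mul_le_mul_of_nonneg_right hεc (hP0 n)
  linarith

end Tauberian

end InfErg

end

/-! ### Hitting sets, return tails and recurrence -/

noncomputable section

namespace InfErg

variable {X : Type*}

/-- Points whose orbit visits `A` at a time in `[0, n]`. -/
def hitSet (T : X → X) (A : Set X) (n : ℕ) : Set X :=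
  ⋃ k ∈ Finset.range (n + 1), T^[k] ⁻¹' A

/-- Points of `A` that do not return to `A` at a time in `[1, n]`. -/
def noReturn (T : X → X) (A : Set X) (n : ℕ) : Set X :=
  A \ ⋃ k ∈ Finset.range n, T^[k + 1] ⁻¹' A

/-- The measure of the set of points of `A` with return time larger than `n`. -/
def returnTail [MeasurableSpace X] (T : X → X) (m : Measure X) (A : Set X) (n : ℕ) : ℝ :=
  (m (noReturn T A n)).toReal

section Sets

variable {T : X → X} {A B : Set X}

lemma mem_hitSet {n : ℕ} {x : X} : x ∈ hitSet T A n ↔ ∃ k ≤ n, T^[k] x ∈ A := by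
  simp [hitSet]

lemma mem_noReturn {n : ℕ} {x : X} :
    x ∈ noReturn T A n ↔ x ∈ A ∧ ∀ k, 1 ≤ k → k ≤ n → T^[k] x ∉ A := by
  simp only [noReturn, Set.mem_sdiff, Set.mem_iUnion, Finset.mem_range, Set.mem_preimage,
    exists_prop, not_exists, not_and]
  refine and_congr_right fun _ => ⟨fun h k hk hkn => ?_, fun h k hk => h _ (by omega) hk⟩
  obtain ⟨j, rfl⟩ := Nat.exists_eq_add_of_le' hk
  exact h j hkn

lemma noReturn_subset (n : ℕ) : noReturn T A n ⊆ A := Set.sdiff_subset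

lemma noReturn_antitone : Antitone (noReturn T A) := fun _ _ hij _ hx =>
  mem_noReturn.2 ⟨(mem_noReturn.1 hx).1, fun k hk hki => (mem_noReturn.1 hx).2 k hk (hki.trans hij)⟩

lemma hitSet_monotone : Monotone (hitSet T A) := fun _ _ hij _ hx =>
  let ⟨k, hk, h⟩ := mem_hitSet.1 hx
  mem_hitSet.2 ⟨k, hk.trans hij, h⟩

lemma hitSet_mono (h : B ⊆ A) (n : ℕ) : hitSet T B n ⊆ hitSet T A n := fun _ hx =>
  let ⟨k, hk, hx⟩ := mem_hitSet.1 hx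
  mem_hitSet.2 ⟨k, hk, h hx⟩

lemma hitSet_zero : hitSet T A 0 = A := by simp [hitSet]

lemma noReturn_zero : noReturn T A 0 = A := by simp [noReturn]

lemma noReturn_succ (n : ℕ) : noReturn T A (n + 1) = A \ T ⁻¹' hitSet T A n := by
  ext x
  rw [mem_noReturn, Set.mem_sdiff, Set.mem_preimage, mem_hitSet]
  push Not
  refine and_congr_right fun _ => ⟨fun h k hk => ?_, fun h k hk hkn => ?_⟩
  · rw [← Function.iterate_succ_apply]
    exact h _ (by omega) (by omega)
  · obtain ⟨j, rfl⟩ := Nat.exists_eq_add_of_le' hk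
    rw [Function.iterate_succ_apply]
    exact h j (by omega)

lemma hitSet_succ (n : ℕ) :
    hitSet T A (n + 1) = T ⁻¹' hitSet T A n ∪ noReturn T A (n + 1) := by
  rw [noReturn_succ, Set.union_sdiff_self]
  ext x
  rw [Set.mem_union, Set.mem_preimage, mem_hitSet, mem_hitSet]
  constructor
  · rintro ⟨k, hk, h⟩
    rcases k with _ | k
    · exact Or.inr h
    · exact Or.inl ⟨k, by omega, h⟩
  · rintro (⟨k, hk, h⟩ | h)
    · exact ⟨k + 1, by omega, h⟩
    · exact ⟨0, by omega, h⟩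

lemma disjoint_preimage_hitSet_noReturn (n : ℕ) :
    Disjoint (T ⁻¹' hitSet T A n) (noReturn T A (n + 1)) := by
  rw [noReturn_succ]
  exact Set.disjoint_sdiff_right

/-- A visit in [0, n + 1] either occurs at a positive time or occurs at time 0 only. Iterated, this
is the decomposition at the last visit, the source of the renewal equation. -/
lemma indicator_hitSet_succ (n : ℕ) (x : X) :
    (hitSet T A (n + 1)).indicator (1 : X → ENNReal) x
      = (hitSet T A n).indicator 1 (T x) + (noReturn T A (n + 1)).indicator 1 x := by
  rw [hitSet_succ, Set.indicator_union_of_disjoint (disjoint_preimage_hitSet_noReturn n)]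
  rfl

/-- The hypothesis `hret` excludes the default value 0 of `sInf ∅`. -/
lemma mem_noReturn_iff_lt_returnTime {x : X} (hx : x ∈ A) (hret : ∃ n, 1 ≤ n ∧ T^[n] x ∈ A)
    (j : ℕ) : x ∈ noReturn T A j ↔ j < returnTime T A x := by
  have hmem : 1 ≤ returnTime T A x ∧ T^[returnTime T A x] x ∈ A := Nat.sInf_mem hret
  rw [mem_noReturn]
  constructor
  · rintro ⟨-, h⟩
    by_contra hj
    exact h _ hmem.1 (not_lt.1 hj) hmem.2
  · refine fun h => ⟨hx, fun k hk hkj hkA => ?_⟩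
    have : returnTime T A x ≤ k := Nat.sInf_le ⟨hk, hkA⟩
    omega

end Sets

variable [MeasurableSpace X] {T : X → X} {m : Measure X} {A B : Set X}

lemma measurableSet_hitSet (hT : Measurable T) (hA : MeasurableSet A) (n : ℕ) :
    MeasurableSet (hitSet T A n) :=
  Finset.measurableSet_biUnion _ fun k _ => (hT.iterate k) hA

lemma measurableSet_noReturn (hT : Measurable T) (hA : MeasurableSet A) (n : ℕ) :
    MeasurableSet (noReturn T A n) :=
  hA.diff (Finset.measurableSet_biUnion _ fun k _ => (hT.iterate (k + 1)) hA)

/-- Invariance of m turns the recursion for hitting sets into a formula for increments. It exhibits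
the wandering rate as the partial sums of a nonincreasing sequence, as the Tauberian theorem
requires. -/
lemma measure_hitSet (hT : MeasurePreserving T m m) (hA : MeasurableSet A) (n : ℕ) :
    m (hitSet T A n) = ∑ k ∈ Finset.range (n + 1), m (noReturn T A k) := by
  induction n with
  | zero => simp [hitSet_zero, noReturn_zero]
  | succ n ih =>
    rw [Finset.sum_range_succ, ← ih, hitSet_succ,
      measure_union (disjoint_preimage_hitSet_noReturn n)
        (measurableSet_noReturn hT.measurable hA _),
      hT.measure_preimage (measurableSet_hitSet hT.measurable hA n).nullMeasurableSet]

lemma measure_noReturn_ne_top (hA : FinPos m A) (n : ℕ) : m (noReturn T A n) ≠ ⊤ :=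
  ((measure_mono (noReturn_subset n)).trans_lt hA.2.2).ne

lemma measure_hitSet_ne_top (hT : MeasurePreserving T m m) (hA : FinPos m A) (n : ℕ) :
    m (hitSet T A n) ≠ ⊤ := by
  rw [measure_hitSet hT hA.1]
  exact ENNReal.sum_ne_top.2 fun k _ => measure_noReturn_ne_top hA k

lemma wanderingRate_eq_sum (hT : MeasurePreserving T m m) (hA : FinPos m A) (n : ℕ) :
    wanderingRate T m A n = ∑ k ∈ Finset.range (n + 1), returnTail T m A k := by
  rw [show wanderingRate T m A n = (m (hitSet T A n)).toReal from rfl, measure_hitSet hT hA.1,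
    ENNReal.toReal_sum fun k _ => measure_noReturn_ne_top hA k]
  rfl

lemma wanderingRate_mono (hT : MeasurePreserving T m m) (hA : FinPos m A) (h : B ⊆ A) (n : ℕ) :
    wanderingRate T m B n ≤ wanderingRate T m A n :=
  ENNReal.toReal_mono (measure_hitSet_ne_top hT hA n) (measure_mono (hitSet_mono h n))

lemma returnTail_nonneg (n : ℕ) : 0 ≤ returnTail T m A n := ENNReal.toReal_nonneg

lemma returnTail_antitone (hA : FinPos m A) : Antitone (returnTail T m A) := fun _ _ hij =>
  ENNReal.toReal_mono (measure_noReturn_ne_top hA _) (measure_mono (noReturn_antitone hij))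

lemma returnTail_zero : returnTail T m A 0 = (m A).toReal := by
  rw [returnTail, noReturn_zero]

lemma FinPos.toReal_pos (hA : FinPos m A) : 0 < (m A).toReal :=
  ENNReal.toReal_pos hA.2.1.ne' hA.2.2.ne

lemma summable_pow_mul_returnTail (hA : FinPos m A) {z : ℝ} (hz0 : 0 < z) (hz1 : z < 1) :
    Summable fun n => z ^ n * returnTail T m A n := by
  refine summable_pow_mul_of_linear (C := (m A).toReal) (Eventually.of_forall fun n => ?_) hz0 hz1
  rw [abs_of_nonneg (returnTail_nonneg n)]
  have h1 := returnTail_antitone (T := T) hA n.zero_le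
  rw [returnTail_zero] at h1
  have h2 : 0 ≤ (m A).toReal * n := by positivity
  linarith

lemma summable_pow_mul_wanderingRate (hT : MeasurePreserving T m m) (hA : FinPos m A) {z : ℝ}
    (hz0 : 0 < z) (hz1 : z < 1) : Summable fun n => z ^ n * wanderingRate T m A n := by
  refine summable_pow_mul_of_linear (C := (m A).toReal) (Eventually.of_forall fun n => ?_) hz0 hz1
  rw [abs_of_nonneg (show 0 ≤ wanderingRate T m A n from ENNReal.toReal_nonneg),
    wanderingRate_eq_sum hT hA]
  have := partialSum_add_le (returnTail_antitone (T := T) hA) 0 n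
  simp only [zero_add, Finset.range_one, Finset.sum_singleton, returnTail_zero] at this
  linarith

lemma powSum_returnTail (hT : MeasurePreserving T m m) (hA : FinPos m A) {z : ℝ}
    (hz0 : 0 < z) (hz1 : z < 1) :
    powSum (returnTail T m A) z = (1 - z) * powSum (wanderingRate T m A) z := by
  have h := summable_pow_mul_wanderingRate hT hA hz0 hz1
  have : wanderingRate T m A = fun n => ∑ k ∈ Finset.range (n + 1), returnTail T m A k :=
    funext (wanderingRate_eq_sum hT hA)
  rw [this] at h ⊢
  exact powSum_eq_of_partialSum h

lemma not_summable_wanderingRate (hT : MeasurePreserving T m m) (hA : FinPos m A) :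
    ¬ Summable (wanderingRate T m A) := by
  intro h
  have h1 := h.tendsto_atTop_zero
  have h2 : ∀ n, (m A).toReal ≤ wanderingRate T m A n := fun n => by
    refine ENNReal.toReal_mono (measure_hitSet_ne_top hT hA n) (measure_mono ?_)
    intro x hx
    exact mem_hitSet.2 ⟨0, n.zero_le, hx⟩
  exact hA.toReal_pos.not_ge (ge_of_tendsto' h1 h2)

/-- The set of points visiting A infinitely often is strictly invariant, hence null or conull. By
Poincaré recurrence it contains almost all of A, so it is not null. -/
lemma ae_frequently_iterate_mem (hcons : Conservative T m) (herg : Ergodic T m)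
    (hA : MeasurableSet A) (hA0 : m A ≠ 0) : ∀ᵐ x ∂m, ∃ᶠ n in atTop, T^[n] x ∈ A := by
  have hT := herg.measurable
  set R : Set X := {x | ∃ᶠ n in atTop, T^[n] x ∈ A} with hR
  have hRm : MeasurableSet R := by
    have : R = ⋂ N, ⋃ n ≥ N, T^[n] ⁻¹' A := by
      ext x
      simp [hR, frequently_atTop]
    rw [this]
    exact MeasurableSet.iInter fun N => MeasurableSet.iUnion fun n => MeasurableSet.iUnion fun _ =>
      (hT.iterate n) hA
  have hRi : T ⁻¹' R = R := by
    ext x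
    simp only [hR, Set.mem_preimage, Set.mem_ofPred_eq, ← Function.iterate_succ_apply]
    exact (frequently_map (m := fun n => n + 1) (f := atTop)
      (P := fun n => T^[n] x ∈ A)).symm.trans (by rw [map_add_atTop_eq_nat])
  rcases herg.ae_mem_or_ae_notMem hRm hRi with h | h
  · exact h
  · exfalso
    refine hA0 ?_
    have h2 := hcons.ae_mem_imp_frequently_image_mem hA.nullMeasurableSet
    rw [measure_eq_zero_iff_ae_notMem]
    filter_upwards [h, h2] with x hx hx2 hxA
    exact hx (hx2 hxA)

/-- Pointwise on A, 1 - z^φ = (1 - z) Σ_{n<φ} z^n, and n < φ means no return up to time n. The rest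
is interchange of sum and integral. -/
lemma returnLaplace_eq_powSum (hcons : Conservative T m) (hT : Measurable T) (hA : FinPos m A)
    {s : ℝ} (hs : 0 < s) :
    returnLaplace T m A s = (1 - Real.exp (-s)) * powSum (returnTail T m A) (Real.exp (-s)) := by
  set z := Real.exp (-s) with hz
  have hz0 : 0 < z := Real.exp_pos _
  have hz1 : z < 1 := Real.exp_lt_one_iff.2 (by linarith)
  have hint : ∀ n, IntegrableOn (fun x => z ^ n * (noReturn T A n).indicator (1 : X → ℝ) x) A m := by
    intro n
    refine Integrable.const_mul (IntegrableOn.integrable ?_) _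
    exact (integrable_indicator_iff (measurableSet_noReturn hT hA.1 n)).2
      (integrableOn_const (by
        rw [Measure.restrict_apply (measurableSet_noReturn hT hA.1 n)]
        exact ((measure_mono Set.inter_subset_right).trans_lt hA.2.2).ne))
  have hval : ∀ n, ∫ x in A, z ^ n * (noReturn T A n).indicator (1 : X → ℝ) x ∂m
      = z ^ n * returnTail T m A n := by
    intro n
    rw [integral_const_mul, integral_indicator_one (measurableSet_noReturn hT hA.1 n),
      Measure.real, Measure.restrict_apply (measurableSet_noReturn hT hA.1 n),
      Set.inter_eq_left.2 (noReturn_subset n)]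
    rfl
  have hsum : HasSum (fun n => z ^ n * returnTail T m A n)
      (∫ x in A, ∑' n, z ^ n * (noReturn T A n).indicator (1 : X → ℝ) x ∂m) := by
    have := hasSum_integral_of_summable_integral_norm hint (by
      have h0 : ∀ n, ∫ x in A, ‖z ^ n * (noReturn T A n).indicator (1 : X → ℝ) x‖ ∂m
          = z ^ n * returnTail T m A n := fun n => by
        rw [← hval]
        refine integral_congr_ae (Eventually.of_forall fun x => ?_)
        exact Real.norm_of_nonneg (mul_nonneg (pow_nonneg hz0.le n)
          (Set.indicator_nonneg (fun _ _ => zero_le_one) x))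
      simpa only [h0] using summable_pow_mul_returnTail hA hz0 hz1)
    simpa only [hval] using this
  rw [powSum, hsum.tsum_eq, ← integral_const_mul, returnLaplace]
  refine integral_congr_ae ?_
  filter_upwards [ae_restrict_mem hA.1,
    ae_restrict_of_ae (hcons.ae_mem_imp_frequently_image_mem hA.1.nullMeasurableSet)] with x hx hrec
  obtain ⟨k, hk1, hk⟩ := (hrec hx).forall_exists_of_atTop 1
  set r := returnTime T A x with hr
  have hterm : ∀ n, z ^ n * (noReturn T A n).indicator (1 : X → ℝ) x
      = if n ∈ Finset.range r then z ^ n else 0 := by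
    intro n
    have := mem_noReturn_iff_lt_returnTime hx ⟨k, hk1, hk⟩ n
    by_cases h : n < r
    · simp [this.2 h, h]
    · simp [mt this.1 h, h]
  simp only [hterm]
  rw [tsum_eq_sum (s := Finset.range r) fun n hn => if_neg hn,
    Finset.sum_congr rfl fun n hn => if_pos hn, mul_neg_geom_sum, hz, ← Real.exp_nat_mul]
  congr 2
  ring

end InfErg

end

/-! ### Duality for the transfer operator and the renewal equation -/

noncomputable section

namespace InfErg

variable {X : Type*} [MeasurableSpace X] {T : X → X} {m : Measure X} {A B : Set X}
  {F : X → ENNReal}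

lemma aemeasurable_iterate_transfer (hF : AEMeasurable F m) (k : ℕ) :
    AEMeasurable ((transfer T m)^[k] F) m := by
  rcases k with _ | k
  · exact hF
  · rw [Function.iterate_succ_apply']
    exact (Measure.measurable_rnDeriv _ _).aemeasurable

lemma measurable_iterate_transfer (hF : Measurable F) (k : ℕ) :
    Measurable ((transfer T m)^[k] F) := by
  rcases k with _ | k
  · exact hF
  · rw [Function.iterate_succ_apply']
    exact Measure.measurable_rnDeriv _ _

lemma tendsto_lintegral_mul_hitSet (hcons : Conservative T m) (herg : Ergodic T m)
    (hF : AEMeasurable F m) (hA : FinPos m A) :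
    Tendsto (fun n => ∫⁻ x, F x * (hitSet T A n).indicator 1 x ∂m) atTop (𝓝 (∫⁻ x, F x ∂m)) := by
  refine lintegral_tendsto_of_tendsto_of_monotone (fun n => hF.mul (measurable_one.indicator
    (measurableSet_hitSet herg.measurable hA.1 n)).aemeasurable) ?_ ?_
  · refine Eventually.of_forall fun x i j hij => mul_le_mul_right ?_ _
    exact Set.indicator_le_indicator_of_subset (hitSet_monotone hij) (fun _ => zero_le) x
  · filter_upwards [ae_frequently_iterate_mem hcons herg hA.1 hA.2.1.ne'] with x hx
    obtain ⟨k, hk⟩ := hx.exists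
    refine tendsto_const_nhds.congr' ?_
    filter_upwards [eventually_ge_atTop k] with n hn
    have : x ∈ hitSet T A n := mem_hitSet.2 ⟨k, hn, hk⟩
    simp [this]

section Duality

variable [SigmaFinite m]

/-- As T preserves m, the image of F dm is absolutely continuous, so the Radon–Nikodym derivative
loses no singular part. -/
lemma lintegral_transfer_mul (hT : MeasurePreserving T m m) (hF : AEMeasurable F m)
    {g : X → ENNReal} (hg : Measurable g) :
    ∫⁻ x, transfer T m F x * g x ∂m = ∫⁻ x, F x * g (T x) ∂m := by
  have hac : (m.withDensity F).map T ≪ m := by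
    have := (withDensity_absolutelyContinuous m F).map hT.measurable
    rwa [hT.map_eq] at this
  rw [transfer, lintegral_rnDeriv_mul hac hg.aemeasurable, lintegral_map hg hT.measurable]
  exact lintegral_withDensity_eq_lintegral_mul₀ hF (hg.comp hT.measurable).aemeasurable

lemma lintegral_iterate_transfer_mul (hT : MeasurePreserving T m m) (hF : AEMeasurable F m)
    (k : ℕ) {g : X → ENNReal} (hg : Measurable g) :
    ∫⁻ x, (transfer T m)^[k] F x * g x ∂m = ∫⁻ x, F x * g (T^[k] x) ∂m := by
  induction k generalizing g with
  | zero => rfl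
  | succ k ih =>
    rw [Function.iterate_succ_apply', lintegral_transfer_mul hT (aemeasurable_iterate_transfer hF k) hg]
    simp only [Function.iterate_succ_apply' T]
    exact ih (hg.comp hT.measurable)

lemma lintegral_iterate_transfer (hT : MeasurePreserving T m m) (hF : AEMeasurable F m) (k : ℕ) :
    ∫⁻ x, (transfer T m)^[k] F x ∂m = ∫⁻ x, F x ∂m := by
  simpa using lintegral_iterate_transfer_mul hT hF k (g := fun _ => 1) measurable_const

lemma ae_iterate_transfer_ne_top (hT : MeasurePreserving T m m) (hF : AEMeasurable F m)
    (hFi : ∫⁻ x, F x ∂m ≠ ⊤) : ∀ᵐ x ∂m, ∀ k, (transfer T m)^[k] F x ≠ ⊤ := by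
  rw [ae_all_iff]
  intro k
  filter_upwards [ae_lt_top' (aemeasurable_iterate_transfer hF k)
    (by rwa [lintegral_iterate_transfer hT hF])] with x hx
  exact hx.ne

/-- The resolvent `∑ z ^ k T̂ ^ k` of the transfer operator. -/
def resolvent (T : X → X) (m : Measure X) (F : X → ENNReal) (z : ENNReal) (x : X) : ENNReal :=
  ∑' k, z ^ k * (transfer T m)^[k] F x

/-- The renewal equation. -/
lemma lintegral_resolvent_mul (hT : MeasurePreserving T m m) (hF : AEMeasurable F m)
    (hFi : ∫⁻ x, F x ∂m ≠ ⊤) (hA : MeasurableSet A) {z : ENNReal} (hz : z < 1) :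
    ∫⁻ x, resolvent T m F z x * ∑' n, z ^ n * (noReturn T A n).indicator 1 x ∂m
      = ∑' n, z ^ n * ∫⁻ x, F x * (hitSet T A n).indicator 1 x ∂m := by
  set G : X → ENNReal := fun x => ∑' n, z ^ n * (hitSet T A n).indicator 1 x with hG
  set h : X → ENNReal := fun x => ∑' n, z ^ n * (noReturn T A n).indicator 1 x with hh
  have hVm : ∀ n, Measurable ((hitSet T A n).indicator (1 : X → ENNReal)) := fun n =>
    measurable_one.indicator (measurableSet_hitSet hT.measurable hA n)
  have hGm : Measurable G := Measurable.tsum fun n => (hVm n).const_mul _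
  have hhm : Measurable h := Measurable.tsum fun n => (measurable_one.indicator
    (measurableSet_noReturn hT.measurable hA n)).const_mul _
  -- The recursion for hitting sets in generating-function form. Duality then moves the composition
  -- with T onto F, and iteration yields the renewal sum up to a remainder.
  have hrec : ∀ x, G x = z * G (T x) + h x := by
    intro x
    simp only [hG, hh]
    rw [tsum_eq_zero_add' ENNReal.summable,
      tsum_eq_zero_add' (f := fun n => z ^ n * (noReturn T A n).indicator 1 x) ENNReal.summable,
      ← ENNReal.tsum_mul_left]
    simp only [indicator_hitSet_succ, mul_add, hitSet_zero, noReturn_zero]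
    rw [ENNReal.tsum_add]
    simp only [pow_succ', mul_assoc]
    ring
  set P : ℕ → X → ENNReal := fun k => (transfer T m)^[k] F with hP
  have hPm : ∀ k, AEMeasurable (P k) m := aemeasurable_iterate_transfer hF
  have hstep : ∀ k, ∫⁻ x, P k x * G x ∂m
      = z * ∫⁻ x, P (k + 1) x * G x ∂m + ∫⁻ x, P k x * h x ∂m := by
    intro k
    have h1 : ∫⁻ x, P (k + 1) x * G x ∂m = ∫⁻ x, P k x * G (T x) ∂m := by
      simp only [hP, Function.iterate_succ_apply']
      exact lintegral_transfer_mul hT (hPm k) hGm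
    have h2 : AEMeasurable (fun x => P k x * G (T x)) m :=
      (hPm k).mul (hGm.comp hT.measurable).aemeasurable
    rw [h1, ← lintegral_const_mul'' _ h2, ← lintegral_add_left' (h2.const_mul z)]
    refine lintegral_congr fun x => ?_
    rw [hrec x]
    ring
  have hiter : ∀ K, ∫⁻ x, F x * G x ∂m = ∑ k ∈ Finset.range K, z ^ k * ∫⁻ x, P k x * h x ∂m
      + z ^ K * ∫⁻ x, P K x * G x ∂m := by
    intro K
    induction K with
    | zero => simp [hP]
    | succ K ih =>
      rw [ih, hstep K, Finset.sum_range_succ, pow_succ]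
      ring
  have hGle : ∀ x, G x ≤ (1 - z)⁻¹ := fun x => by
    rw [← ENNReal.tsum_geometric]
    refine ENNReal.tsum_le_tsum fun n => ?_
    refine (mul_le_mul_right (Set.indicator_le_self' (fun _ _ => zero_le) x) _).trans ?_
    simp
  -- The transfer operator preserves integrals and G ≤ 1/(1 - z), so the remainder after K steps is
  -- at most z^K C. Finiteness of ∫ F makes it vanish.
  set C : ENNReal := (∫⁻ x, F x ∂m) * (1 - z)⁻¹ with hC
  have hCtop : C ≠ ⊤ := ENNReal.mul_ne_top hFi (ENNReal.inv_ne_top.2 (tsub_pos_of_lt hz).ne')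
  have hrem : ∀ K, ∫⁻ x, P K x * G x ∂m ≤ C := fun K => by
    calc ∫⁻ x, P K x * G x ∂m ≤ ∫⁻ x, P K x * (1 - z)⁻¹ ∂m :=
          lintegral_mono fun x => mul_le_mul_right (hGle x) _
      _ = C := by rw [lintegral_mul_const'' _ (hPm K), lintegral_iterate_transfer hT hF]
  have hlim : Tendsto (fun K => z ^ K * ∫⁻ x, P K x * G x ∂m) atTop (𝓝 0) := by
    have h0 : Tendsto (fun K => z ^ K * C) atTop (𝓝 0) := by
      simpa using ENNReal.Tendsto.mul_const (ENNReal.tendsto_pow_atTop_nhds_zero_of_lt_one hz)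
        (Or.inr hCtop)
    exact tendsto_of_tendsto_of_tendsto_of_le_of_le tendsto_const_nhds h0 (fun _ => zero_le)
      fun K => mul_le_mul_right (hrem K) _
  have hmain : ∫⁻ x, F x * G x ∂m = ∑' k, z ^ k * ∫⁻ x, P k x * h x ∂m := by
    have h1 := (ENNReal.tendsto_nat_tsum fun k => z ^ k * ∫⁻ x, P k x * h x ∂m).add hlim
    simp only [← hiter, add_zero] at h1
    exact tendsto_nhds_unique tendsto_const_nhds h1
  have hL : ∫⁻ x, F x * G x ∂m = ∑' n, z ^ n * ∫⁻ x, F x * (hitSet T A n).indicator 1 x ∂m := by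
    have hm : ∀ n, AEMeasurable (fun x => F x * (hitSet T A n).indicator (1 : X → ENNReal) x) m :=
      fun n => hF.mul (hVm n).aemeasurable
    simp only [← fun n => lintegral_const_mul'' (z ^ n) (hm n)]
    rw [← lintegral_tsum fun n => (hm n).const_mul _]
    refine lintegral_congr fun x => ?_
    simp only [hG, ← ENNReal.tsum_mul_left]
    exact tsum_congr fun n => by ring
  rw [← hL, hmain]
  have hm : ∀ k, AEMeasurable (fun x => P k x * h x) m := fun k => (hPm k).mul hhm.aemeasurable
  simp only [← fun n => lintegral_const_mul'' (z ^ n) (hm n)]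
  rw [← lintegral_tsum fun n => (hm n).const_mul _]
  refine lintegral_congr fun x => ?_
  simp only [resolvent, ← ENNReal.tsum_mul_right]
  exact tsum_congr fun n => by ring

/-- By duality the integral is that of F times the number of visits to A before time n, which
increases to infinity almost everywhere. -/
lemma tendsto_setLIntegral_sum_iterate_transfer (hcons : Conservative T m) (herg : Ergodic T m)
    (hF : AEMeasurable F m) (hF0 : ∫⁻ x, F x ∂m ≠ 0) (hA : FinPos m A) :
    Tendsto (fun n => ∫⁻ x in A, ∑ k ∈ Finset.range n, (transfer T m)^[k] F x ∂m)
      atTop (𝓝 ⊤) := by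
  have hT := herg.toMeasurePreserving
  have hAm : Measurable (A.indicator (1 : X → ENNReal)) := measurable_one.indicator hA.1
  have hAk : ∀ k, Measurable fun x => A.indicator (1 : X → ENNReal) (T^[k] x) := fun k =>
    hAm.comp (hT.measurable.iterate k)
  have heq : ∀ n, ∫⁻ x in A, ∑ k ∈ Finset.range n, (transfer T m)^[k] F x ∂m
      = ∫⁻ x, F x * ∑ k ∈ Finset.range n, A.indicator 1 (T^[k] x) ∂m := by
    intro n
    rw [lintegral_finsetSum' _ fun k _ => (aemeasurable_iterate_transfer hF k).restrict]
    simp only [Finset.mul_sum]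
    rw [lintegral_finsetSum' (f := fun k x => F x * A.indicator 1 (T^[k] x)) _
      fun k _ => hF.mul (hAk k).aemeasurable]
    refine Finset.sum_congr rfl fun k _ => ?_
    rw [← lintegral_iterate_transfer_mul hT hF k hAm, ← lintegral_indicator hA.1]
    refine lintegral_congr fun x => ?_
    by_cases hx : x ∈ A <;> simp [hx]
  simp only [heq]
  have htop : ∫⁻ x, F x * ⊤ ∂m = ⊤ := by
    rw [lintegral_mul_const'' _ hF, ENNReal.mul_top hF0]
  rw [← htop]
  refine lintegral_tendsto_of_tendsto_of_monotone (fun n => hF.mul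
    (Finset.measurable_sum _ fun k _ => hAk k).aemeasurable) ?_ ?_
  · exact Eventually.of_forall fun x i j hij => mul_le_mul_right
      (Finset.sum_le_sum_of_subset (Finset.range_mono hij)) _
  · filter_upwards [ae_frequently_iterate_mem hcons herg hA.1 hA.2.1.ne'] with x hx
    refine ENNReal.Tendsto.const_mul ?_ (Or.inl ENNReal.top_ne_zero)
    have h1 := ENNReal.tendsto_nat_tsum fun k => A.indicator (1 : X → ENNReal) (T^[k] x)
    have h2 : ∑' k, A.indicator (1 : X → ENNReal) (T^[k] x) = ⊤ := by
      by_contra hne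
      have hfin := ENNReal.finite_const_le_of_tsum_ne_top hne one_ne_zero
      refine (Nat.frequently_atTop_iff_infinite.1 hx) (hfin.subset fun k hk => ?_)
      have hk' : T^[k] x ∈ A := hk
      simp [hk']
    rwa [h2] at h1

end Duality

end InfErg

end

/-! ### Real dual sums and the asymptotic renewal equation -/

noncomputable section

namespace InfErg

variable {X : Type*} [MeasurableSpace X] {T : X → X} {m : Measure X} {A B : Set X}
  {f : X → ℝ}

lemma L1Pos.lintegral_eq (hf : L1Pos m f) :
    ∫⁻ x, ENNReal.ofReal (f x) ∂m = ENNReal.ofReal (∫ x, f x ∂m) :=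
  (ofReal_integral_eq_lintegral_ofReal hf.1 hf.2.1).symm

lemma L1Pos.lintegral_ne_top (hf : L1Pos m f) : ∫⁻ x, ENNReal.ofReal (f x) ∂m ≠ ⊤ := by
  rw [hf.lintegral_eq]
  exact ENNReal.ofReal_ne_top

lemma L1Pos.lintegral_ne_zero (hf : L1Pos m f) : ∫⁻ x, ENNReal.ofReal (f x) ∂m ≠ 0 := by
  rw [hf.lintegral_eq]
  exact (ENNReal.ofReal_pos.2 hf.2.2).ne'

lemma L1Pos.aemeasurable (hf : L1Pos m f) : AEMeasurable (fun x => ENNReal.ofReal (f x)) m :=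
  hf.1.aemeasurable.ennreal_ofReal

lemma FinPos.l1Pos_indicator (hA : FinPos m A) : L1Pos m (A.indicator 1) := by
  refine ⟨(integrable_indicator_iff hA.1).2 (integrableOn_const hA.2.2.ne),
    Eventually.of_forall (Set.indicator_nonneg fun _ _ => zero_le_one), ?_⟩
  rw [integral_indicator_one hA.1]
  exact hA.toReal_pos

lemma dualSum_nonneg (n : ℕ) (x : X) : 0 ≤ dualSum T m f n x :=
  Finset.sum_nonneg fun _ _ => ENNReal.toReal_nonneg

lemma dualSum_mono (x : X) : Monotone fun n => dualSum T m f n x := fun _ _ hij =>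
  Finset.sum_le_sum_of_subset_of_nonneg (Finset.range_mono hij) fun _ _ _ => ENNReal.toReal_nonneg

lemma measurable_dualSum (hf : Measurable f) (n : ℕ) : Measurable (dualSum T m f n) :=
  Finset.measurable_sum _ fun k _ => (measurable_iterate_transfer hf.ennreal_ofReal k).ennreal_toReal

variable [SigmaFinite m]

lemma ae_ofReal_dualSum (hT : MeasurePreserving T m m) (hf : L1Pos m f) :
    ∀ᵐ x ∂m, ∀ n, ENNReal.ofReal (dualSum T m f n x)
      = ∑ k ∈ Finset.range n, (transfer T m)^[k] (fun y => ENNReal.ofReal (f y)) x := by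
  filter_upwards [ae_iterate_transfer_ne_top hT hf.aemeasurable hf.lintegral_ne_top] with x hx n
  rw [dualSum, ENNReal.ofReal_sum_of_nonneg fun _ _ => ENNReal.toReal_nonneg]
  exact Finset.sum_congr rfl fun k _ => ENNReal.ofReal_toReal (hx k)

/-- Summation by parts, off a null set that does not depend on z. The shift to n + 1 appears because
`dualSum` stops at n - 1. -/
lemma ae_resolvent_eq (hT : MeasurePreserving T m m) (hf : L1Pos m f) :
    ∀ᵐ x ∂m, ∀ z : ℝ, 0 < z → Summable (fun n => z ^ n * dualSum T m f (n + 1) x) →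
      resolvent T m (fun y => ENNReal.ofReal (f y)) (ENNReal.ofReal z) x
        = ENNReal.ofReal ((1 - z) * powSum (fun n => dualSum T m f (n + 1) x) z) := by
  filter_upwards [ae_iterate_transfer_ne_top hT hf.aemeasurable hf.lintegral_ne_top]
    with x hx z hz0 hs
  have h := hasSum_pow_mul_of_partialSum hs
  have h2 : (1 - z) * powSum (fun n => dualSum T m f (n + 1) x) z = _ := h.tsum_eq.symm
  rw [h2, ENNReal.ofReal_tsum_of_nonneg
    (fun n => mul_nonneg (pow_nonneg hz0.le n) ENNReal.toReal_nonneg) h.summable, resolvent]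
  refine tsum_congr fun n => ?_
  rw [ENNReal.ofReal_mul (pow_nonneg hz0.le n), ENNReal.ofReal_pow hz0.le,
    ENNReal.ofReal_toReal (hx n)]

/-- The asymptotic renewal equation for a set on which the resolvents converge uniformly. -/
lemma tendsto_mul_powSum_returnTail (hcons : Conservative T m) (herg : Ergodic T m)
    (hf : L1Pos m f) (hA : FinPos m A) {ι : Type*} {l : Filter ι} {z u : ι → ℝ}
    (hz : Tendsto z l (𝓝[<] 1)) (hu : ∀ᶠ i in l, 0 < u i)
    (h : ∀ ε : ℝ, 0 < ε → ∀ᶠ i in l, ∀ᵐ x ∂(m.restrict A),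
      ENNReal.ofReal ((∫ y, f y ∂m - ε) * u i)
          ≤ resolvent T m (fun y => ENNReal.ofReal (f y)) (ENNReal.ofReal (z i)) x ∧
        resolvent T m (fun y => ENNReal.ofReal (f y)) (ENNReal.ofReal (z i)) x
          ≤ ENNReal.ofReal ((∫ y, f y ∂m + ε) * u i)) :
    Tendsto (fun i => u i * ((1 - z i) * powSum (returnTail T m A) (z i))) l (𝓝 1) := by
  have hT := herg.toMeasurePreserving
  set F : X → ENNReal := fun y => ENNReal.ofReal (f y) with hF
  set μ : ℝ := ∫ y, f y ∂m with hμ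
  have hμ0 : 0 < μ := hf.2.2
  have hFm : AEMeasurable F m := hf.aemeasurable
  have hFi : ∫⁻ x, F x ∂m ≠ ⊤ := hf.lintegral_ne_top
  set I : ℕ → ENNReal := fun n => ∫⁻ x, F x * (hitSet T A n).indicator 1 x ∂m with hI
  have hIle : ∀ n, I n ≤ ∫⁻ x, F x ∂m := fun n => lintegral_mono fun x => by
    refine (mul_le_mul_right (Set.indicator_le_self' (fun _ _ => zero_le) x) _).trans ?_
    simp
  have hIfin : ∀ n, I n ≠ ⊤ := fun n => ((hIle n).trans_lt hFi.lt_top).ne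
  set w : ℕ → ℝ := fun n => (I n).toReal with hw
  have hwt : Tendsto w atTop (𝓝 μ) := by
    have h1 := tendsto_lintegral_mul_hitSet hcons herg hFm hA
    have h2 := (ENNReal.tendsto_toReal hFi).comp h1
    rwa [show (∫⁻ x, F x ∂m).toReal = μ by
      rw [hF, hf.lintegral_eq, ENNReal.toReal_ofReal hμ0.le]] at h2
  have hwle : ∀ n, w n ≤ μ := fun n => by
    have := ENNReal.toReal_mono hFi (hIle n)
    rwa [hF, hf.lintegral_eq, ENNReal.toReal_ofReal hμ0.le] at this
  have hws : ∀ z : ℝ, 0 < z → z < 1 → Summable fun n => z ^ n * w n := fun z h0 h1 => by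
    refine summable_pow_mul_of_linear (C := μ) (Eventually.of_forall fun n => ?_) h0 h1
    rw [abs_of_nonneg ENNReal.toReal_nonneg]
    have : 0 ≤ μ * n := by positivity
    linarith [hwle n]
  have hW : Tendsto (fun i => (1 - z i) * powSum w (z i)) l (𝓝 μ) :=
    (tendsto_one_sub_mul_powSum hwt).comp hz
  have hz01 : ∀ᶠ i in l, 0 < z i ∧ z i < 1 := hz.eventually eventually_mem_Ioo_nhdsLT_one
  set κ : ι → ℝ := fun i => u i * ((1 - z i) * powSum (returnTail T m A) (z i)) with hκ
  have hκpos : ∀ᶠ i in l, 0 < κ i := by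
    filter_upwards [hu, hz01] with i hui ⟨h0, h1⟩
    have hq0 : 0 < powSum (returnTail T m A) (z i) := by
      refine (summable_pow_mul_returnTail hA h0 h1).tsum_pos
        (fun n => mul_nonneg (pow_nonneg h0.le n) (returnTail_nonneg n)) 0 ?_
      rw [pow_zero, one_mul, returnTail_zero]
      exact hA.toReal_pos
    have : 0 < 1 - z i := by linarith
    positivity
  -- The weight `H` vanishes off A, so the bounds assumed on A may be inserted into the renewal
  -- equation. The condition ε < μ keeps the lower constant nonnegative, so that `ENNReal.ofReal` is
  -- multiplicative.
  have hcmp : ∀ ε : ℝ, 0 < ε → ε < μ → ∀ᶠ i in l,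
      (μ - ε) * κ i ≤ (1 - z i) * powSum w (z i) ∧
      (1 - z i) * powSum w (z i) ≤ (μ + ε) * κ i := by
    intro ε hε hεμ
    filter_upwards [h ε hε, hu, hz01] with i hi hui ⟨h0, h1⟩
    set r : ENNReal := ENNReal.ofReal (z i) with hr
    have hr1 : r < 1 := by rw [hr, ENNReal.ofReal_lt_one]; exact h1
    set H : X → ENNReal := fun x => ∑' n, r ^ n * (noReturn T A n).indicator 1 x with hH
    have hNm : ∀ n, Measurable ((noReturn T A n).indicator (1 : X → ENNReal)) := fun n =>
      measurable_one.indicator (measurableSet_noReturn hT.measurable hA.1 n)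
    have hHm : Measurable H := Measurable.tsum fun n => (hNm n).const_mul _
    have hHint : ∫⁻ x, H x ∂m = ENNReal.ofReal (powSum (returnTail T m A) (z i)) := by
      rw [hH, lintegral_tsum fun n => ((hNm n).const_mul _).aemeasurable, powSum,
        ENNReal.ofReal_tsum_of_nonneg
          (fun n => mul_nonneg (pow_nonneg h0.le n) (returnTail_nonneg n))
          (summable_pow_mul_returnTail hA h0 h1)]
      refine tsum_congr fun n => ?_
      rw [lintegral_const_mul _ (hNm n), ENNReal.ofReal_mul (pow_nonneg h0.le n),
        ENNReal.ofReal_pow h0.le, returnTail, ENNReal.ofReal_toReal (measure_noReturn_ne_top hA n),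
        lintegral_indicator_one (measurableSet_noReturn hT.measurable hA.1 n)]
    have hRen : ∫⁻ x, resolvent T m F r x * H x ∂m = ENNReal.ofReal (powSum w (z i)) := by
      rw [hH, lintegral_resolvent_mul hT hFm hFi hA.1 hr1, powSum,
        ENNReal.ofReal_tsum_of_nonneg
          (fun n => mul_nonneg (pow_nonneg h0.le n) ENNReal.toReal_nonneg) (hws _ h0 h1)]
      refine tsum_congr fun n => ?_
      rw [ENNReal.ofReal_mul (pow_nonneg h0.le n), ENNReal.ofReal_pow h0.le,
        ENNReal.ofReal_toReal (hIfin n)]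
    have hHA : ∀ x ∉ A, H x = 0 := fun x hx => by
      rw [hH, ENNReal.tsum_eq_zero]
      intro n
      simp [show x ∉ noReturn T A n from fun h' => hx (noReturn_subset n h')]
    have hi' := (ae_restrict_iff' hA.1).1 hi
    have hlow : ∫⁻ x, ENNReal.ofReal ((μ - ε) * u i) * H x ∂m
        ≤ ∫⁻ x, resolvent T m F r x * H x ∂m := by
      refine lintegral_mono_ae ?_
      filter_upwards [hi'] with x hx
      by_cases hxA : x ∈ A
      · exact mul_le_mul_left (hx hxA).1 _
      · simp [hHA x hxA]
    have hupp : ∫⁻ x, resolvent T m F r x * H x ∂m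
        ≤ ∫⁻ x, ENNReal.ofReal ((μ + ε) * u i) * H x ∂m := by
      refine lintegral_mono_ae ?_
      filter_upwards [hi'] with x hx
      by_cases hxA : x ∈ A
      · exact mul_le_mul_left (hx hxA).2 _
      · simp [hHA x hxA]
    have hq0 := powSum_nonneg (returnTail_nonneg (T := T) (m := m) (A := A)) h0.le
    have hw0 : 0 ≤ powSum w (z i) := powSum_nonneg (fun _ => ENNReal.toReal_nonneg) h0.le
    rw [lintegral_const_mul _ hHm, hHint, hRen,
      ← ENNReal.ofReal_mul (mul_nonneg (by linarith) hui.le)] at hlow hupp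
    rw [ENNReal.ofReal_le_ofReal_iff hw0] at hlow
    rw [ENNReal.ofReal_le_ofReal_iff
      (mul_nonneg (mul_nonneg (by linarith) hui.le) hq0)] at hupp
    have h1z : 0 ≤ 1 - z i := by linarith
    constructor
    · calc (μ - ε) * κ i
          = (1 - z i) * ((μ - ε) * u i * powSum (returnTail T m A) (z i)) := by rw [hκ]; ring
        _ ≤ _ := mul_le_mul_of_nonneg_left hlow h1z
    · calc _ ≤ (1 - z i) * ((μ + ε) * u i * powSum (returnTail T m A) (z i)) :=
            mul_le_mul_of_nonneg_left hupp h1z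
        _ = (μ + ε) * κ i := by rw [hκ]; ring
  have hratio : Tendsto (fun i => (1 - z i) * powSum w (z i) / κ i) l (𝓝 μ) := by
    rw [Metric.tendsto_nhds]
    intro ε hε
    have hε' : 0 < min (ε / 2) (μ / 2) := lt_min (by linarith) (by linarith)
    have hεμ : min (ε / 2) (μ / 2) < μ := (min_le_right _ _).trans_lt (by linarith)
    filter_upwards [hcmp _ hε' hεμ, hκpos] with i ⟨hi1, hi2⟩ hκi
    rw [Real.dist_eq, abs_lt]
    have h1 := (le_div_iff₀ hκi).2 hi1
    have h2 := (div_le_iff₀ hκi).2 hi2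
    have h3 := min_le_left (ε / 2) (μ / 2)
    constructor <;> linarith
  have hfin := hW.div hratio hμ0.ne'
  rw [div_self hμ0.ne'] at hfin
  refine hfin.congr' ?_
  filter_upwards [hκpos, hW.eventually (lt_mem_nhds hμ0)] with i hi hi2
  exact div_div_cancel₀ hi2.ne'

/-- If a_n < K, the integral of the n-th dual sum over A is at most C K m(A), but these integrals
tend to infinity. -/
lemma tendsto_atTop_of_dualSum_le (hcons : Conservative T m) (herg : Ergodic T m)
    (hf : L1Pos m f) (hA : FinPos m A) {a : ℕ → ℝ} {C : ℝ} (hC : 0 < C)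
    (h : ∀ᶠ n in atTop, ∀ᵐ x ∂(m.restrict A), dualSum T m f n x ≤ C * a n) :
    Tendsto a atTop atTop := by
  have hT := herg.toMeasurePreserving
  have h1 := tendsto_setLIntegral_sum_iterate_transfer hcons herg hf.aemeasurable
    hf.lintegral_ne_zero hA
  rw [tendsto_atTop]
  intro K
  have hK : ENNReal.ofReal (C * K) * m A < ⊤ := ENNReal.mul_lt_top ENNReal.ofReal_lt_top hA.2.2
  filter_upwards [h, h1.eventually (lt_mem_nhds hK)] with n hn hn2
  by_contra hlt
  refine hn2.not_ge ?_
  rw [← setLIntegral_const]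
  refine lintegral_mono_ae ?_
  filter_upwards [hn, ae_restrict_of_ae (ae_ofReal_dualSum hT hf)] with x hx hx2
  rw [← hx2 n]
  refine ENNReal.ofReal_le_ofReal (hx.trans ?_)
  exact mul_le_mul_of_nonneg_left (not_le.1 hlt).le hC.le

/-- The n-th dual sum has integral n m(f), so Markov's inequality applies. Linear growth is what
makes the power series of `a` converge for all z < 1. -/
lemma eventually_le_linear_of_measure_le (hT : MeasurePreserving T m m) (hf : L1Pos m f)
    {a : ℕ → ℝ} {κ δ : ℝ} (hκ : 0 < κ) (hδ : 0 < δ)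
    (h : ∀ᶠ n in atTop, ENNReal.ofReal δ ≤ m {x | κ * a n ≤ dualSum T m f n x}) :
    ∃ C : ℝ, ∀ᶠ n : ℕ in atTop, a n ≤ C * n := by
  set μ : ℝ := ∫ y, f y ∂m with hμ
  have hμ0 : 0 < μ := hf.2.2
  refine ⟨μ / (κ * δ), ?_⟩
  filter_upwards [h] with n hn
  rcases le_or_gt (a n) 0 with ha | ha
  · exact ha.trans (by positivity)
  have hae : (fun x => ENNReal.ofReal (dualSum T m f n x)) =ᵐ[m]
      fun x => ∑ k ∈ Finset.range n, (transfer T m)^[k] (fun y => ENNReal.ofReal (f y)) x :=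
    (ae_ofReal_dualSum hT hf).mono fun x hx => hx n
  have hS : ∫⁻ x, ENNReal.ofReal (dualSum T m f n x) ∂m = n * ENNReal.ofReal μ := by
    rw [lintegral_congr_ae hae,
      lintegral_finsetSum' _ fun k _ => aemeasurable_iterate_transfer hf.aemeasurable k]
    simp only [lintegral_iterate_transfer hT hf.aemeasurable, hf.lintegral_eq]
    simp [hμ]
  have hSm : AEMeasurable (fun x => ENNReal.ofReal (dualSum T m f n x)) m :=
    (Finset.aemeasurable_fun_sum _ fun k _ =>
      aemeasurable_iterate_transfer hf.aemeasurable k).congr hae.symm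
  have hM := mul_meas_ge_le_lintegral₀ hSm (ENNReal.ofReal (κ * a n))
  have hset : {x | κ * a n ≤ dualSum T m f n x}
      = {x | ENNReal.ofReal (κ * a n) ≤ ENNReal.ofReal (dualSum T m f n x)} := by
    ext x
    exact (ENNReal.ofReal_le_ofReal_iff (dualSum_nonneg n x)).symm
  rw [hS, ← hset] at hM
  have h2 : ENNReal.ofReal (κ * a n * δ) ≤ ENNReal.ofReal (n * μ) := by
    rw [ENNReal.ofReal_mul (p := κ * a n) (by positivity),
      ENNReal.ofReal_mul (p := (n : ℝ)) (by positivity), ENNReal.ofReal_natCast]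
    exact (mul_le_mul_right hn _).trans hM
  rw [ENNReal.ofReal_le_ofReal_iff (by positivity)] at h2
  rw [div_mul_eq_mul_div, le_div_iff₀ (by positivity)]
  linarith

end InfErg

end

/-! ### Uniform sets -/

noncomputable section

namespace InfErg

variable {X : Type*} [MeasurableSpace X] {T : X → X} {m : Measure X} {A B : Set X}
  {f : X → ℝ} [SigmaFinite m]

/-- Uniform convergence of the normalized dual sums passes to the resolvents. -/
lemma tendsto_mul_powSum_returnTail_of_uniform (hcons : Conservative T m) (herg : Ergodic T m)
    (hf : L1Pos m f) (hA : FinPos m A) {a : ℕ → ℝ} (ha : ∀ n, 1 ≤ n → 0 < a n)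
    (h : ∀ ε : ℝ, 0 < ε → ∀ᶠ n in atTop, ∀ᵐ x ∂(m.restrict A),
      |dualSum T m f n x / a n - ∫ y, f y ∂m| ≤ ε) (hB : FinPos m B) (hBA : B ⊆ A) :
    Tendsto (fun z => (1 - z) * powSum (fun n => a (n + 1)) z
      * ((1 - z) * powSum (returnTail T m B) z)) (𝓝[<] 1) (𝓝 1) := by
  have hT := herg.toMeasurePreserving
  set μ : ℝ := ∫ y, f y ∂m with hμ
  have hμ0 : 0 < μ := hf.2.2
  set α : ℕ → ℝ := fun n => a (n + 1) with hα
  have hα0 : ∀ n, 0 < α n := fun n => ha _ (by omega)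
  have hatop : Tendsto a atTop atTop := by
    refine tendsto_atTop_of_dualSum_le (C := 2 * μ) hcons herg hf hA (by positivity) ?_
    filter_upwards [h μ hμ0, eventually_ge_atTop 1] with n hn hn1
    filter_upwards [hn] with x hx
    have := (div_le_iff₀ (ha n hn1)).1 (sub_le_iff_le_add.1 (abs_le.1 hx).2)
    linarith
  obtain ⟨C, hC⟩ : ∃ C : ℝ, ∀ᶠ n : ℕ in atTop, a n ≤ C * n := by
    refine eventually_le_linear_of_measure_le (κ := μ / 2) (δ := (m A).toReal) hT hf
      (by positivity) hA.toReal_pos ?_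
    filter_upwards [h (μ / 2) (by positivity), eventually_ge_atTop 1] with n hn hn1
    rw [ENNReal.ofReal_toReal hA.2.2.ne]
    refine measure_mono_ae ?_
    filter_upwards [(ae_restrict_iff' hA.1).1 hn] with x hx hxA
    have h1 : μ / 2 ≤ dualSum T m f n x / a n := by
      have := (abs_le.1 (hx hxA)).1
      linarith
    exact (le_div_iff₀ (ha n hn1)).1 h1
  have hαtop : Tendsto α atTop atTop := hatop.comp (tendsto_add_atTop_nat 1)
  have hαs : ∀ z : ℝ, 0 < z → z < 1 → Summable fun n => z ^ n * α n := fun z h0 h1 => by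
    refine summable_pow_mul_of_linear (C := C) ?_ h0 h1
    filter_upwards [(tendsto_add_atTop_nat 1).eventually hC] with n hn
    rw [abs_of_pos (hα0 n)]
    exact_mod_cast hn
  have hαns : ¬ Summable α := fun hs => not_tendsto_nhds_of_tendsto_atTop hαtop _ hs.tendsto_atTop_zero
  have hPtop := tendsto_powSum_atTop (fun n => (hα0 n).le) hαns hαs
  refine tendsto_mul_powSum_returnTail hcons herg hf hB (z := id)
    (u := fun z => (1 - z) * powSum α z) tendsto_id ?_ fun ε hε => ?_
  · filter_upwards [eventually_mem_Ioo_nhdsLT_one, hPtop.eventually_gt_atTop 0] with z ⟨_, hz1⟩ hz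
    exact mul_pos (by linarith) hz
  · obtain ⟨N, hN⟩ := eventually_atTop.1 (h (ε / 2) (half_pos hε))
    have hN' : ∀ᵐ x ∂(m.restrict B), ∀ n, N ≤ n → |dualSum T m f n x / a n - μ| ≤ ε / 2 := by
      refine ae_mono (Measure.restrict_mono_set m hBA) ?_
      exact ae_all_iff.2 fun n => eventually_imp_distrib_left.2 (hN n)
    -- Below N the uniform estimate is unavailable, but dual sums increase with n and are therefore
    -- at most the one at N + 1, which is estimated. This gives a head bound independent of x.
    set K : ℝ := (μ + ε / 2) * a (N + 1) + μ * ∑ j ∈ Finset.range N, α j with hK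
    filter_upwards [hPtop.eventually_ge_atTop (N * K / (ε / 2)), eventually_mem_Ioo_nhdsLT_one]
      with z hz ⟨hz0, hz1⟩
    filter_upwards [hN', ae_restrict_of_ae (ae_resolvent_eq hT hf)] with x hx hres
    set S : ℕ → ℝ := fun n => dualSum T m f (n + 1) x with hS
    have hSα : ∀ n, N ≤ n + 1 → |S n - μ * α n| ≤ ε / 2 * α n := fun n hn => by
      have h1 := hx (n + 1) hn
      have h2 : S n - μ * α n = (S n / α n - μ) * α n := by
        rw [sub_mul, div_mul_cancel₀ _ (hα0 n).ne']
      rw [h2, abs_mul, abs_of_pos (hα0 n)]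
      exact mul_le_mul_of_nonneg_right h1 (hα0 n).le
    have hSK : ∀ n, n < N → |S n - μ * α n| ≤ K := fun n hn => by
      have h1 : S n ≤ S N := dualSum_mono x (by omega)
      have h2 := (abs_le.1 (hSα N (by omega))).2
      have h3 : α n ≤ ∑ j ∈ Finset.range N, α j :=
        Finset.single_le_sum (fun j _ => (hα0 j).le) (Finset.mem_range.2 hn)
      have h4 : μ * α n ≤ μ * ∑ j ∈ Finset.range N, α j := by gcongr
      have h5 : 0 ≤ S n := dualSum_nonneg _ _
      have h6 : 0 < μ * α n := mul_pos hμ0 (hα0 n)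
      have h7 : 0 < α N := hα0 N
      have h8 : K = (μ + ε / 2) * α N + μ * ∑ j ∈ Finset.range N, α j := rfl
      have h9 : 0 < (μ + ε / 2) * α N := by positivity
      rw [abs_le]
      constructor <;> linarith
    obtain ⟨hbs, hb⟩ := abs_powSum_le_add (half_pos hε).le (fun n => (hα0 n).le) hz0 hz1
      (hαs z hz0 hz1) (fun n hn => hSα n (by omega)) hSK
    have hμα : Summable fun n => z ^ n * (μ * α n) := by
      simpa only [mul_left_comm _ μ] using (hαs z hz0 hz1).mul_left μ
    have hSs : Summable fun n => z ^ n * S n := by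
      have := hbs.add hμα
      simpa only [← mul_add, sub_add_cancel] using this
    rw [powSum_sub hSs hμα, powSum_const_mul] at hb
    have hKz : N * K ≤ ε / 2 * powSum α z := by
      rwa [div_le_iff₀' (half_pos hε)] at hz
    obtain ⟨hb1, hb2⟩ := abs_le.1 hb
    have h1z : 0 ≤ 1 - z := by linarith
    rw [id, hres z hz0 hSs]
    constructor <;> refine ENNReal.ofReal_le_ofReal ?_
    · calc (μ - ε) * ((1 - z) * powSum α z) = (1 - z) * ((μ - ε) * powSum α z) := by ring
        _ ≤ _ := mul_le_mul_of_nonneg_left (by linarith) h1z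
    · calc _ ≤ (1 - z) * ((μ + ε) * powSum α z) := mul_le_mul_of_nonneg_left (by linarith) h1z
        _ = (μ + ε) * ((1 - z) * powSum α z) := by ring

/-- Uniform sets have minimal wandering rate. -/
lemma IsUniformSet.hasMinimalWanderingRate (hcons : Conservative T m) (herg : Ergodic T m)
    (hA : IsUniformSet T m A) : HasMinimalWanderingRate T m A := by
  have hT := herg.toMeasurePreserving
  obtain ⟨hA, f, hf, a, ha, h⟩ := hA
  refine ⟨hA, fun B hB hBA => ?_⟩
  have h1 := tendsto_mul_powSum_returnTail_of_uniform hcons herg hf hA ha h hB hBA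
  have h2 := tendsto_mul_powSum_returnTail_of_uniform hcons herg hf hA ha h hA subset_rfl
  have hWA : wanderingRate T m A = fun n => ∑ k ∈ Finset.range (n + 1), returnTail T m A k :=
    funext (wanderingRate_eq_sum hT hA)
  have hWB : wanderingRate T m B = fun n => ∑ k ∈ Finset.range (n + 1), returnTail T m B k :=
    funext (wanderingRate_eq_sum hT hB)
  -- Both sets satisfy the asymptotic renewal equation with the same factor, which cancels in the
  -- quotient.
  have hequiv : powSum (wanderingRate T m B) ~[𝓝[<] 1] powSum (wanderingRate T m A) := by
    refine isEquivalent_of_tendsto_one ?_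
    have h3 := h1.div h2 one_ne_zero
    rw [div_one] at h3
    refine h3.congr' ?_
    filter_upwards [eventually_mem_Ioo_nhdsLT_one, h2.eventually_ne one_ne_zero] with z ⟨h0, h1⟩ hne
    simp only [Pi.div_apply, powSum_returnTail hT hA h0 h1, powSum_returnTail hT hB h0 h1] at hne ⊢
    rw [mul_div_mul_left _ _ (left_ne_zero_of_mul hne), mul_div_mul_left _ _ (by linarith),
      mul_div_mul_left _ _ (by linarith)]
  rw [hWA, hWB] at hequiv ⊢
  refine isEquivalent_partialSum_of_powSum (returnTail_antitone hA) (returnTail_antitone hB)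
    returnTail_nonneg returnTail_nonneg (fun n => ?_) hequiv
  rw [← wanderingRate_eq_sum hT hA, ← wanderingRate_eq_sum hT hB]
  exact wanderingRate_mono hT hA hBA n

end InfErg

end

/-! ### Convergence in mean and domination on a subset -/

noncomputable section

namespace InfErg

section ConvergenceInMean

variable {X : Type*} [MeasurableSpace X] {ν : Measure X} [IsFiniteMeasure ν]

lemma tendsto_lintegral_enorm_of_tendstoInMeasure {g : ℕ → X → ℝ} (hg : ∀ n, Measurable (g n))
    {C : ENNReal} (hC : C ≠ ⊤) (hb : ∀ᶠ n in atTop, ∀ᵐ x ∂ν, ‖g n x‖ₑ ≤ C)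
    (h : TendstoInMeasure ν g atTop 0) :
    Tendsto (fun n => ∫⁻ x, ‖g n x‖ₑ ∂ν) atTop (𝓝 0) := by
  rcases eq_or_ne ν 0 with rfl | hν
  · simp
  have hν0 : ν Set.univ ≠ 0 := Measure.measure_univ_ne_zero.2 hν
  have hνt : ν Set.univ ≠ ⊤ := measure_ne_top ν _
  rw [ENNReal.tendsto_nhds_zero]
  intro ε hε
  set δ : ENNReal := ε / 2 / ν Set.univ with hδ
  have hδ0 : 0 < δ := ENNReal.div_pos (ENNReal.half_pos hε.ne').ne' hνt
  have h1 : Tendsto (fun n => C * ν {x | δ ≤ edist (g n x) 0}) atTop (𝓝 0) := by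
    simpa using ENNReal.Tendsto.const_mul (h δ hδ0) (Or.inr hC)
  filter_upwards [hb, h1.eventually (ge_mem_nhds (ENNReal.half_pos hε.ne'))] with n hn hn2
  set E : Set X := {x | δ ≤ edist (g n x) 0} with hE
  have hEm : MeasurableSet E := measurableSet_le measurable_const ((hg n).edist measurable_const)
  calc ∫⁻ x, ‖g n x‖ₑ ∂ν ≤ ∫⁻ x, (δ + E.indicator (fun _ => C) x) ∂ν := by
        refine lintegral_mono_ae ?_
        filter_upwards [hn] with x hx
        by_cases hxE : x ∈ E
        · rw [Set.indicator_of_mem hxE]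
          exact hx.trans le_add_self
        · rw [Set.indicator_of_notMem hxE, add_zero, ← edist_zero_right]
          exact (not_le.1 hxE).le
    _ = δ * ν Set.univ + C * ν E := by
        rw [lintegral_add_left measurable_const, lintegral_const, lintegral_indicator_const hEm]
    _ ≤ ε / 2 + ε / 2 := by
        gcongr
        rw [hδ, ENNReal.div_mul_cancel hν0 hνt]
    _ = ε := ENNReal.add_halves ε

/-- Convergence in mean passes to the ratios of power series. -/
lemma tendsto_lintegral_powSum_div {S : ℕ → X → ℝ} {α : ℕ → ℝ} {M μ : ℝ}
    (hS : ∀ n, Measurable (S n)) (hα : ∀ n, 0 < α n) (hαn : ¬ Summable α)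
    (hαs : ∀ z : ℝ, 0 < z → z < 1 → Summable fun n => z ^ n * α n)
    (hM : ∀ᵐ x ∂ν, ∀ n, |S n x| ≤ M * α n)
    (h : Tendsto (fun n => ∫⁻ x, ‖S n x / α n - μ‖ₑ ∂ν) atTop (𝓝 0)) :
    Tendsto (fun z => ∫⁻ x, ‖powSum (fun n => S n x) z / powSum α z - μ‖ₑ ∂ν)
      (𝓝[<] 1) (𝓝 0) := by
  set J : ℕ → ENNReal := fun n => ∫⁻ x, ‖S n x / α n - μ‖ₑ ∂ν with hJ
  have hJfin : ∀ n, J n ≠ ⊤ := fun n => by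
    have h1 : J n ≤ ∫⁻ _, ENNReal.ofReal (M + |μ|) ∂ν := by
      refine lintegral_mono_ae ?_
      filter_upwards [hM] with x hx
      rw [Real.enorm_eq_ofReal_abs]
      refine ENNReal.ofReal_le_ofReal ((abs_sub _ _).trans ?_)
      have := (div_le_iff₀ (hα n)).2 (hx n)
      rw [abs_div, abs_of_pos (hα n)]
      linarith
    rw [lintegral_const] at h1
    exact (h1.trans_lt (ENNReal.mul_lt_top ENNReal.ofReal_lt_top (measure_lt_top _ _))).ne
  set j : ℕ → ℝ := fun n => (J n).toReal with hj
  have hj0 : Tendsto j atTop (𝓝 0) := (ENNReal.tendsto_toReal ENNReal.zero_ne_top).comp h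
  have hαj : (fun n => α n * j n) =o[atTop] α := by
    have : j =o[atTop] fun _ => (1 : ℝ) := (isLittleO_one_iff ℝ).2 hj0
    simpa using (isBigO_refl α atTop).mul_isLittleO this
  have hlim := (powSum_isLittleO (fun n => (hα n).le) hαn hαs hαj).tendsto_div_nhds_zero
  have hlim' := ENNReal.tendsto_ofReal hlim
  rw [ENNReal.ofReal_zero] at hlim'
  refine tendsto_of_tendsto_of_tendsto_of_le_of_le' tendsto_const_nhds hlim'
    (Eventually.of_forall fun _ => zero_le) ?_
  have hPtop := tendsto_powSum_atTop (fun n => (hα n).le) hαn hαs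
  filter_upwards [eventually_mem_Ioo_nhdsLT_one, hPtop.eventually_gt_atTop 0]
    with z ⟨hz0, hz1⟩ hP
  set P : ℝ := powSum α z with hPdef
  have hjs : Summable fun n => z ^ n * (α n * j n) := by
    refine Summable.of_norm_bounded_eventually_nat (hαs z hz0 hz1) ?_
    filter_upwards [hj0.eventually (ge_mem_nhds zero_lt_one)] with n hn
    have hzn := pow_pos hz0 n
    have hj' : 0 ≤ j n := ENNReal.toReal_nonneg
    rw [Real.norm_of_nonneg (mul_nonneg hzn.le (mul_nonneg (hα n).le hj'))]
    exact mul_le_mul_of_nonneg_left (mul_le_of_le_one_right (hα n).le hn) hzn.le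
  have hc0 : ∀ n, 0 ≤ z ^ n * α n / P := fun n =>
    div_nonneg (mul_nonneg (pow_nonneg hz0.le n) (hα n).le) hP.le
  -- The difference is an average of S_n/α_n - μ with weights z^n α_n / P of total mass 1. Its mean
  -- is thus at most the weighted average of the `J n`, which tends to 0 by the Abelian lemma.
  have hpt : ∀ᵐ x ∂ν, ‖powSum (fun n => S n x) z / P - μ‖ₑ
      ≤ ∑' n, ENNReal.ofReal (z ^ n * α n / P) * ‖S n x / α n - μ‖ₑ := by
    filter_upwards [hM] with x hx
    have hSs : Summable fun n => z ^ n * S n x := by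
      refine Summable.of_norm_bounded ((hαs z hz0 hz1).mul_left M) fun n => ?_
      rw [norm_mul, Real.norm_of_nonneg (pow_nonneg hz0.le n), Real.norm_eq_abs]
      calc z ^ n * |S n x| ≤ z ^ n * (M * α n) := by gcongr; exact hx n
        _ = _ := by ring
    have h1 : powSum (fun n => S n x) z / P - μ
        = ∑' n, z ^ n * α n / P * (S n x / α n - μ) := by
      have h2 := (hSs.hasSum.div_const P).sub (((hαs z hz0 hz1).hasSum.div_const P).mul_right μ)
      rw [show ∑' n, z ^ n * α n = P from rfl, div_self hP.ne', one_mul] at h2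
      rw [powSum, ← h2.tsum_eq]
      refine tsum_congr fun n => ?_
      have := (hα n).ne'
      field_simp
    rw [h1]
    refine enorm_tsum_le_tsum_enorm.trans (ENNReal.tsum_le_tsum fun n => ?_)
    rw [enorm_mul, Real.enorm_of_nonneg (hc0 n)]
  have hJm : ∀ n, Measurable fun x => ‖S n x / α n - μ‖ₑ := fun n =>
    (((hS n).div_const _).sub_const _).enorm
  refine (lintegral_mono_ae hpt).trans ?_
  rw [lintegral_tsum fun n => ((hJm n).const_mul _).aemeasurable, powSum, ← tsum_div_const,
    ENNReal.ofReal_tsum_of_nonneg _ (hjs.div_const P)]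
  · refine ENNReal.tsum_le_tsum fun n => ?_
    rw [lintegral_const_mul _ (hJm n),
      show z ^ n * (α n * j n) / P = z ^ n * α n / P * j n by ring,
      ENNReal.ofReal_mul (hc0 n), hj, ENNReal.ofReal_toReal (hJfin n)]
  · exact fun n => div_nonneg (mul_nonneg (pow_nonneg hz0.le n)
      (mul_nonneg (hα n).le ENNReal.toReal_nonneg)) hP.le

end ConvergenceInMean

variable {X : Type*} [MeasurableSpace X] {T : X → X} {m : Measure X} {A B : Set X}
  {f : X → ℝ}

/-- A finite limsup bounds the ratios at almost every point, so A is covered up to a null set by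
countably many sets with a common bound, and one has positive measure. This is the domination that
convergence in measure alone does not provide. -/
lemma exists_finPos_subset_dualSum_le (hfm : Measurable f) {a : ℕ → ℝ} {μ : ℝ}
    (ha : ∀ n, 1 ≤ n → 0 < a n)
    (hlim : ∀ᵐ x ∂m, limsup (fun n => ((dualSum T m f n x / a n : ℝ) : EReal)) atTop = (μ : EReal))
    (hA : FinPos m A) :
    ∃ B ⊆ A, FinPos m B ∧ ∃ M : ℝ, 0 < M ∧
      ∀ x ∈ B, ∀ n, 1 ≤ n → dualSum T m f n x ≤ M * a n := by
  set s : ℕ → Set X := fun k => A ∩ ⋂ n ≥ 1, {x | dualSum T m f n x ≤ (k + 1 : ℝ) * a n} with hs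
  have hsm : ∀ k, MeasurableSet (s k) := fun k => hA.1.inter <| MeasurableSet.iInter fun n =>
    MeasurableSet.iInter fun _ => measurableSet_le (measurable_dualSum hfm n) measurable_const
  have hcover : A ≤ᵐ[m] ⋃ k, s k := by
    filter_upwards [hlim] with x hx hxA
    have h1 : ∀ᶠ n in atTop, ((dualSum T m f n x / a n : ℝ) : EReal) < ((μ + 1 : ℝ) : EReal) :=
      eventually_lt_of_limsup_lt (by rw [hx]; exact_mod_cast lt_add_one μ)
    obtain ⟨N, hN⟩ := eventually_atTop.1 h1
    obtain ⟨k, hk⟩ := exists_nat_ge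
      (max (μ + 1) (∑ n ∈ Finset.range N, |dualSum T m f n x / a n|))
    refine Set.mem_iUnion.2 ⟨k, hxA, ?_⟩
    simp only [Set.mem_iInter, Set.mem_ofPred_eq]
    intro n hn
    rw [← div_le_iff₀ (ha n hn)]
    rcases le_or_gt N n with h | h
    · have := EReal.coe_lt_coe_iff.1 (hN n h)
      linarith [le_max_left (μ + 1) (∑ n ∈ Finset.range N, |dualSum T m f n x / a n|)]
    · have h2 := Finset.single_le_sum (f := fun n => |dualSum T m f n x / a n|)
        (fun _ _ => abs_nonneg _) (Finset.mem_range.2 h)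
      linarith [le_abs_self (dualSum T m f n x / a n),
        le_max_right (μ + 1) (∑ n ∈ Finset.range N, |dualSum T m f n x / a n|)]
  obtain ⟨k, hk⟩ := exists_measure_pos_of_not_measure_iUnion_null
    (hA.2.1.trans_le (measure_mono_ae hcover)).ne'
  refine ⟨s k, Set.inter_subset_left, ⟨hsm k, hk,
    (measure_mono Set.inter_subset_left).trans_lt hA.2.2⟩, k + 1, by positivity, fun x hx n hn => ?_⟩
  have := hx.2
  simp only [Set.mem_iInter, Set.mem_ofPred_eq] at this
  exact this n hn

end InfErg

end

/-! ### Sets of minimal wandering rate -/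

noncomputable section

namespace InfErg

variable {X : Type*} [MeasurableSpace X] {T : X → X} {m : Measure X} {A B : Set X}

/-- Equivalence of wandering rates passes to transforms by the Abelian lemma, so this half needs no
Tauberian argument. -/
lemma HasMinimalWanderingRate.powSum_returnTail_isEquivalent (hT : MeasurePreserving T m m)
    (hA : HasMinimalWanderingRate T m A) (hB : FinPos m B) (hBA : B ⊆ A) :
    powSum (returnTail T m B) ~[𝓝[<] 1] powSum (returnTail T m A) := by
  have h := powSum_isEquivalent (fun n => ENNReal.toReal_nonneg)
    (not_summable_wanderingRate hT hA.1) (fun z h0 h1 => summable_pow_mul_wanderingRate hT hA.1 h0 h1)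
    (fun z h0 h1 => summable_pow_mul_wanderingRate hT hB h0 h1) (hA.2 B hB hBA)
  refine ((IsEquivalent.refl (u := fun z : ℝ => 1 - z)).mul h).congr_left ?_ |>.congr_right ?_
  · filter_upwards [eventually_mem_Ioo_nhdsLT_one] with z ⟨h0, h1⟩
    exact (powSum_returnTail hT hB h0 h1).symm
  · filter_upwards [eventually_mem_Ioo_nhdsLT_one] with z ⟨h0, h1⟩
    exact (powSum_returnTail hT hA.1 h0 h1).symm

variable [SigmaFinite m]

lemma IsReturnSequence.tendsto_atTop (hcons : Conservative T m) (herg : Ergodic T m)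
    {a : ℕ → ℝ} (ha : IsReturnSequence T m a) (hA : FinPos m A) : Tendsto a atTop atTop := by
  obtain ⟨B, -, hB, M, hM, hBM⟩ := exists_finPos_subset_dualSum_le
    (measurable_one.indicator hA.1) ha.1 (ha.2.2 _ hA.l1Pos_indicator) hA
  refine tendsto_atTop_of_dualSum_le hcons herg hA.l1Pos_indicator hB hM ?_
  filter_upwards [eventually_ge_atTop 1] with n hn
  filter_upwards [ae_restrict_mem hB.1] with x hx
  exact hBM x hx n hn

/-- By convergence in measure on A, the dual sum is eventually at least (μ/2) a_n on a set of
measure at least m(A)/2. -/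
lemma IsReturnSequence.exists_le_linear (herg : Ergodic T m)
    {a : ℕ → ℝ} (ha : IsReturnSequence T m a) (hA : FinPos m A) :
    ∃ C : ℝ, ∀ᶠ n : ℕ in atTop, a n ≤ C * n := by
  have hf := hA.l1Pos_indicator
  set μ : ℝ := ∫ y, A.indicator (1 : X → ℝ) y ∂m with hμ
  have hμ0 : 0 < μ := hf.2.2
  have hfin : IsFiniteMeasure (m.restrict A) := ⟨by simpa using hA.2.2⟩
  have hm := (tendstoInMeasure_iff_dist.1
    (ha.2.1 _ hf (m.restrict A) hfin Measure.absolutelyContinuous_restrict)) (μ / 2) (by positivity)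
  refine eventually_le_linear_of_measure_le (κ := μ / 2) (δ := (m A).toReal / 2)
    herg.toMeasurePreserving hf (by positivity) (half_pos hA.toReal_pos) ?_
  have hhalf : 0 < m A / 2 := ENNReal.half_pos hA.2.1.ne'
  filter_upwards [hm.eventually (ge_mem_nhds hhalf), eventually_ge_atTop 1] with n hn hn1
  set E : Set X := {x | μ / 2 ≤ dist (dualSum T m (A.indicator 1) n x / a n) μ} with hE
  set G : Set X := {x | μ / 2 * a n ≤ dualSum T m (A.indicator 1) n x} with hG
  have hcover : Set.univ ⊆ E ∪ G := fun x _ => by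
    by_contra hx
    rw [Set.mem_union, not_or] at hx
    have h1 : |dualSum T m (A.indicator 1) n x / a n - μ| < μ / 2 := by
      simpa [hE, Real.dist_eq] using hx.1
    have h2 : dualSum T m (A.indicator 1) n x < μ / 2 * a n := by simpa [hG] using hx.2
    have h3 := (div_lt_iff₀ (ha.1 n hn1)).2 h2
    linarith [(abs_lt.1 h1).1]
  have h1 : m A ≤ m A / 2 + m G := by
    calc m A = m.restrict A Set.univ := by simp
      _ ≤ m.restrict A (E ∪ G) := measure_mono hcover
      _ ≤ m.restrict A E + m.restrict A G := measure_union_le _ _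
      _ ≤ m A / 2 + m G := add_le_add hn (Measure.restrict_apply_le _ _)
  have h2 : m A / 2 ≤ m G := by
    have h3 : m A / 2 + m A / 2 ≤ m A / 2 + m G := by rwa [ENNReal.add_halves]
    exact (ENNReal.add_le_add_iff_left
      (ENNReal.div_ne_top hA.2.2.ne two_ne_zero)).1 h3
  rwa [ENNReal.ofReal_div_of_pos two_pos, ENNReal.ofReal_toReal hA.2.2.ne, ENNReal.ofReal_ofNat]

lemma IsReturnSequence.summable (herg : Ergodic T m)
    {a : ℕ → ℝ} (ha : IsReturnSequence T m a) (hA : FinPos m A) {z : ℝ} (hz0 : 0 < z)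
    (hz1 : z < 1) : Summable fun n => z ^ n * a (n + 1) := by
  obtain ⟨C, hC⟩ := ha.exists_le_linear herg hA
  refine summable_pow_mul_of_linear (C := C) ?_ hz0 hz1
  filter_upwards [(tendsto_add_atTop_nat 1).eventually hC] with n hn
  rw [abs_of_pos (ha.1 _ (by omega))]
  exact_mod_cast hn

/-- Along a subsequence of any sequence converging to `1`, the asymptotic renewal equation holds
for some subset of a given set. -/
lemma IsReturnSequence.exists_subseq_tendsto (hcons : Conservative T m) (herg : Ergodic T m)
    {a : ℕ → ℝ} (ha : IsReturnSequence T m a) (hA : FinPos m A) {z : ℕ → ℝ}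
    (hz : Tendsto z atTop (𝓝[<] 1)) :
    ∃ φ : ℕ → ℕ, StrictMono φ ∧ ∃ B ⊆ A, FinPos m B ∧
      Tendsto (fun k => (1 - z (φ k)) * powSum (fun n => a (n + 1)) (z (φ k))
        * ((1 - z (φ k)) * powSum (returnTail T m B) (z (φ k)))) atTop (𝓝 1) := by
  have hT := herg.toMeasurePreserving
  have hf := hA.l1Pos_indicator
  set f : X → ℝ := A.indicator 1 with hfdef
  have hfm : Measurable f := measurable_one.indicator hA.1
  set μ : ℝ := ∫ y, f y ∂m with hμ
  have hμ0 : 0 < μ := hf.2.2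
  obtain ⟨A', hA'A, hA', M, hM, hbound⟩ :=
    exists_finPos_subset_dualSum_le hfm ha.1 (ha.2.2 _ hf) hA
  set α : ℕ → ℝ := fun n => a (n + 1) with hα
  have hα0 : ∀ n, 0 < α n := fun n => ha.1 _ (by omega)
  have hαs : ∀ z : ℝ, 0 < z → z < 1 → Summable fun n => z ^ n * α n := fun z h0 h1 =>
    ha.summable herg hA h0 h1
  have hαtop : Tendsto α atTop atTop :=
    (ha.tendsto_atTop hcons herg hA).comp (tendsto_add_atTop_nat 1)
  have hαn : ¬ Summable α := fun hs => not_tendsto_nhds_of_tendsto_atTop hαtop _ hs.tendsto_atTop_zero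
  set ν : Measure X := m.restrict A' with hν
  have hνfin : IsFiniteMeasure ν := ⟨by simpa [hν] using hA'.2.2⟩
  have hνac : ν ≪ m := Measure.absolutelyContinuous_restrict
  have hSm : ∀ n, Measurable (dualSum T m f n) := measurable_dualSum hfm
  have hbound' : ∀ᵐ x ∂ν, ∀ n, |dualSum T m f (n + 1) x| ≤ M * α n := by
    filter_upwards [ae_restrict_mem hA'.1] with x hx n
    rw [abs_of_nonneg (dualSum_nonneg _ _)]
    exact hbound x hx _ (by omega)
  -- On `A'` the ratios are bounded by `M`, so convergence in measure upgrades to convergence in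
  -- mean.
  have hmean : Tendsto (fun n => ∫⁻ x, ‖dualSum T m f (n + 1) x / α n - μ‖ₑ ∂ν) atTop (𝓝 0) := by
    refine tendsto_lintegral_enorm_of_tendstoInMeasure
      (fun n => ((hSm _).div_const _).sub_const _) (C := ENNReal.ofReal (M + |μ|))
      ENNReal.ofReal_ne_top (Eventually.of_forall fun n => ?_) ?_
    · filter_upwards [hbound'] with x hx
      rw [Real.enorm_eq_ofReal_abs]
      refine ENNReal.ofReal_le_ofReal ((abs_sub _ _).trans ?_)
      have := (div_le_iff₀ (hα0 n)).2 (hx n)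
      rw [abs_div, abs_of_pos (hα0 n)]
      linarith
    · have h1 := (ha.2.1 f hf ν hνfin hνac).comp (tendsto_add_atTop_nat 1)
      rw [tendstoInMeasure_iff_dist] at h1 ⊢
      intro ε hε
      simpa [Real.dist_eq] using h1 ε hε
  have hR := tendsto_lintegral_powSum_div (fun n => hSm (n + 1)) hα0 hαn hαs hbound' hmean
  set R : ℝ → X → ℝ := fun z x => powSum (fun n => dualSum T m f (n + 1) x) z / powSum α z with hRdef
  have hRm : ∀ z, Measurable (R z) := fun z =>
    (Measurable.tsum fun n => (hSm (n + 1)).const_mul _).div_const _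
  have hRmeas : TendstoInMeasure ν (fun k => R (z k)) atTop fun _ => μ := by
    refine tendstoInMeasure_of_tendsto_eLpNorm one_ne_zero
      (fun k => (hRm _).aestronglyMeasurable) aestronglyMeasurable_const ?_
    simp only [eLpNorm_one_eq_lintegral_enorm]
    exact hR.comp hz
  obtain ⟨φ, hφ, hae⟩ := hRmeas.exists_seq_tendsto_ae
  have hA'2 : 0 < (m A').toReal / 2 := half_pos hA'.toReal_pos
  -- Egorov, discarding at most half of `A'`, so that uniform convergence holds on a set of positive
  -- measure.
  obtain ⟨t, htA, htm, htle, hunif⟩ := tendstoUniformlyOn_of_ae_tendsto (μ := m) (s := A')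
    (fun k => (hRm (z (φ k))).stronglyMeasurable) stronglyMeasurable_const hA'.1 hA'.2.2.ne
    ((ae_restrict_iff' hA'.1).1 hae) hA'2
  have htlt : m t < m A' := htle.trans_lt (by
    rw [ENNReal.ofReal_lt_iff_lt_toReal hA'2.le hA'.2.2.ne]
    linarith [hA'.toReal_pos])
  have hB : FinPos m (A' \ t) := by
    refine ⟨hA'.1.diff htm, ?_, (measure_mono Set.sdiff_subset).trans_lt hA'.2.2⟩
    rw [measure_sdiff htA htm.nullMeasurableSet (htlt.trans hA'.2.2).ne]
    exact tsub_pos_of_lt htlt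
  have hzφ : Tendsto (fun k => z (φ k)) atTop (𝓝[<] 1) := hz.comp hφ.tendsto_atTop
  have hz01 : ∀ᶠ k in atTop, 0 < z (φ k) ∧ z (φ k) < 1 :=
    hzφ.eventually eventually_mem_Ioo_nhdsLT_one
  have hPpos : ∀ᶠ k in atTop, 0 < powSum α (z (φ k)) := hzφ.eventually
    ((tendsto_powSum_atTop (fun n => (hα0 n).le) hαn hαs).eventually_gt_atTop 0)
  refine ⟨φ, hφ, A' \ t, Set.sdiff_subset.trans hA'A, hB, ?_⟩
  refine tendsto_mul_powSum_returnTail hcons herg hf hB hzφ ?_ fun ε hε => ?_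
  · filter_upwards [hz01, hPpos] with k ⟨_, hk1⟩ hk
    exact mul_pos (by linarith) hk
  · filter_upwards [hz01, hPpos, Metric.tendstoUniformlyOn_iff.1 hunif ε hε] with k ⟨h0, h1⟩ hP hk
    filter_upwards [ae_restrict_mem hB.1, ae_restrict_of_ae (ae_resolvent_eq hT hf)] with x hx hres
    have hSs : Summable fun n => z (φ k) ^ n * dualSum T m f (n + 1) x := by
      refine Summable.of_nonneg_of_le
        (fun n => mul_nonneg (pow_nonneg h0.le n) (dualSum_nonneg _ _)) (fun n => ?_)
        ((hαs _ h0 h1).mul_left M)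
      calc z (φ k) ^ n * dualSum T m f (n + 1) x ≤ z (φ k) ^ n * (M * α n) := by
            gcongr
            exact hbound x hx.1 _ (by omega)
        _ = _ := by ring
    rw [hres _ h0 hSs]
    have hd := hk x hx
    rw [dist_comm, Real.dist_eq, abs_lt] at hd
    have h1z : 0 ≤ 1 - z (φ k) := by linarith
    have hl : μ - ε ≤ R (z (φ k)) x := by linarith [hd.1]
    have hu : R (z (φ k)) x ≤ μ + ε := by linarith [hd.2]
    rw [hRdef, le_div_iff₀ hP] at hl
    rw [hRdef, div_le_iff₀ hP] at hu
    constructor <;> refine ENNReal.ofReal_le_ofReal ?_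
    · calc (μ - ε) * ((1 - z (φ k)) * powSum α (z (φ k)))
          = (1 - z (φ k)) * ((μ - ε) * powSum α (z (φ k))) := by ring
        _ ≤ _ := mul_le_mul_of_nonneg_left hl h1z
    · calc _ ≤ (1 - z (φ k)) * ((μ + ε) * powSum α (z (φ k))) :=
            mul_le_mul_of_nonneg_left hu h1z
        _ = (μ + ε) * ((1 - z (φ k)) * powSum α (z (φ k))) := by ring

/-- The asymptotic renewal equation for sets of minimal wandering rate. -/
lemma IsReturnSequence.tendsto_mul_powSum_returnTail (hcons : Conservative T m)
    (herg : Ergodic T m) {a : ℕ → ℝ} (ha : IsReturnSequence T m a)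
    (hA : HasMinimalWanderingRate T m A) :
    Tendsto (fun z => (1 - z) * powSum (fun n => a (n + 1)) z
      * ((1 - z) * powSum (returnTail T m A) z)) (𝓝[<] 1) (𝓝 1) := by
  -- The subset B varies with the sequence, but its transform is equivalent to that of A, so every
  -- sequence has a subsequence with the required limit.
  refine tendsto_of_subseq_tendsto fun z hz => ?_
  obtain ⟨φ, hφ, B, hBA, hB, hlim⟩ := ha.exists_subseq_tendsto hcons herg hA.1 hz
  refine ⟨φ, ?_⟩
  have heq := (hA.powSum_returnTail_isEquivalent herg.toMeasurePreserving hB hBA).comp_tendsto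
    (hz.comp hφ.tendsto_atTop)
  refine IsEquivalent.tendsto_nhds ?_ hlim
  exact IsEquivalent.refl.mul (IsEquivalent.refl.mul heq)

end InfErg

end

/-! ### Return sequences with nonnegative increments -/

noncomputable section

namespace InfErg

lemma limsup_coe_ereal_le_of_tendsto_sub {x y : ℕ → ℝ}
    (h : Tendsto (fun n => y n - x n) atTop (𝓝 0)) :
    limsup (fun n => (y n : EReal)) atTop ≤ limsup (fun n => (x n : EReal)) atTop := by
  have hv : limsup (fun n => ((y n - x n : ℝ) : EReal)) atTop = 0 :=
    ((continuous_coe_real_ereal.tendsto 0).comp h).limsup_eq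
  have h1 := EReal.limsup_add_le (f := atTop) (u := fun n => (x n : EReal))
    (v := fun n => ((y n - x n : ℝ) : EReal)) (Or.inr (by rw [hv]; exact EReal.zero_ne_top))
    (Or.inr (by rw [hv]; exact EReal.zero_ne_bot))
  rw [hv, add_zero] at h1
  convert! h1 using 2
  ext n
  rw [Pi.add_apply, ← EReal.coe_add, add_sub_cancel]

lemma limsup_coe_ereal_congr {x y : ℕ → ℝ} (h : Tendsto (fun n => y n - x n) atTop (𝓝 0)) :
    limsup (fun n => (y n : EReal)) atTop = limsup (fun n => (x n : EReal)) atTop :=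
  le_antisymm (limsup_coe_ereal_le_of_tendsto_sub h)
    (limsup_coe_ereal_le_of_tendsto_sub (by simpa using h.neg))

variable {X : Type*} [MeasurableSpace X] {T : X → X} {m : Measure X} {A : Set X}

lemma IsReturnSequence.congr {a b : ℕ → ℝ} (ha : IsReturnSequence T m a)
    (hb : ∀ n, 1 ≤ n → 0 < b n) (hab : Tendsto (fun n => a n / b n) atTop (𝓝 1)) :
    IsReturnSequence T m b := by
  have heq : ∀ (f : X → ℝ) (x : X) (n : ℕ), 1 ≤ n → dualSum T m f n x / b n
      = dualSum T m f n x / a n * (a n / b n) := fun f x n hn => by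
    rw [div_mul_div_cancel₀ (ha.1 n hn).ne']
  refine ⟨hb, fun f hf ν hν hνm => ?_, fun f hf => ?_⟩
  · set μ : ℝ := ∫ y, f y ∂m with hμ
    have h := tendstoInMeasure_iff_dist.1 (ha.2.1 f hf ν hν hνm)
    refine tendstoInMeasure_iff_dist.2 fun ε hε => ?_
    refine tendsto_of_tendsto_of_tendsto_of_le_of_le' tendsto_const_nhds
      (h (ε / 4) (by positivity)) (Eventually.of_forall fun _ => zero_le) ?_
    have h1 : Tendsto (fun n => |a n / b n - 1| * |μ|) atTop (𝓝 0) := by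
      simpa using ((hab.sub_const 1).abs.mul_const |μ|)
    filter_upwards [hab.eventually (ge_mem_nhds one_lt_two), eventually_ge_atTop 1,
      h1.eventually (gt_mem_nhds (half_pos hε))] with n hn2 hn1 hnμ
    refine measure_mono fun x hx => ?_
    rw [Set.mem_ofPred_eq, Real.dist_eq] at hx ⊢
    rw [heq f x n hn1] at hx
    set g := dualSum T m f n x / a n
    set r := a n / b n with hr
    have hr0 : 0 ≤ r := (div_pos (ha.1 n hn1) (hb n hn1)).le
    have h2 : g * r - μ = r * (g - μ) + (r - 1) * μ := by ring
    have h3 := abs_add_le (r * (g - μ)) ((r - 1) * μ)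
    rw [← h2, abs_mul, abs_mul, abs_of_nonneg hr0] at h3
    have h4 : r * |g - μ| ≤ 2 * |g - μ| := mul_le_mul_of_nonneg_right hn2 (abs_nonneg _)
    linarith
  · set μ : ℝ := ∫ y, f y ∂m with hμ
    filter_upwards [ha.2.2 f hf] with x hx
    rw [← hx]
    refine limsup_coe_ereal_congr ?_
    have h1 : ∀ᶠ n in atTop, ((dualSum T m f n x / a n : ℝ) : EReal) < ((μ + 1 : ℝ) : EReal) :=
      eventually_lt_of_limsup_lt (by rw [hx]; exact_mod_cast lt_add_one μ)
    have h2 : Tendsto (fun n => (μ + 1) * |a n / b n - 1|) atTop (𝓝 0) := by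
      simpa using ((hab.sub_const 1).abs.const_mul (μ + 1))
    refine squeeze_zero_norm' ?_ h2
    filter_upwards [h1, eventually_ge_atTop 1] with n hn hn1
    have hn' := EReal.coe_lt_coe_iff.1 hn
    rw [heq f x n hn1, ← mul_sub_one, norm_mul, Real.norm_eq_abs, Real.norm_eq_abs,
      abs_of_nonneg (div_nonneg (dualSum_nonneg n x) (ha.1 n hn1).le)]
    exact mul_le_mul_of_nonneg_right hn'.le (abs_nonneg _)

/-- Return sequences are asymptotically nondecreasing. -/
lemma IsReturnSequence.eventually_le_mul {a : ℕ → ℝ} (ha : IsReturnSequence T m a)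
    (hA : FinPos m A) {c : ℝ} (hc : 1 < c) : ∃ N, ∀ k n, N ≤ k → k ≤ n → a k ≤ c * a n := by
  have hf := hA.l1Pos_indicator
  set f : X → ℝ := A.indicator 1 with hfdef
  set μ : ℝ := ∫ y, f y ∂m with hμ
  have hμ0 : 0 < μ := hf.2.2
  -- Solves (μ + δ) / (μ - δ) = c.
  set δ : ℝ := μ * ((c - 1) / (c + 1)) with hδ
  have hδ0 : 0 < δ := mul_pos hμ0 (div_pos (by linarith) (by linarith))
  have hfin : IsFiniteMeasure (m.restrict A) := ⟨by simpa using hA.2.2⟩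
  have hm := (tendstoInMeasure_iff_dist.1
    (ha.2.1 _ hf (m.restrict A) hfin Measure.absolutelyContinuous_restrict)) δ hδ0
  have hpos : 0 < m A / 2 := ENNReal.half_pos hA.2.1.ne'
  obtain ⟨N, hN⟩ := eventually_atTop.1 (hm.eventually (gt_mem_nhds hpos))
  refine ⟨max N 1, fun k n hk hkn => ?_⟩
  have hk0 := ha.1 k (by omega)
  have hn0 := ha.1 n (by omega)
  set E : ℕ → Set X := fun n => {x | δ ≤ dist (dualSum T m f n x / a n) μ} with hE
  -- Each exceptional set has measure below m(A)/2, so some point is good for both k and n.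
  -- Monotonicity of its dual sums compares a_k with a_n.
  have hne : ¬ Set.univ ⊆ E k ∪ E n := fun hsub => by
    have h1 : m A < m A := by
      calc m A = m.restrict A Set.univ := by simp
        _ ≤ m.restrict A (E k) + m.restrict A (E n) :=
          (measure_mono hsub).trans (measure_union_le _ _)
        _ < m A / 2 + m A / 2 := ENNReal.add_lt_add (hN k (by omega)) (hN n (by omega))
        _ = m A := ENNReal.add_halves _
    exact h1.false
  obtain ⟨x, -, hx⟩ := Set.not_subset.1 hne
  rw [Set.mem_union, not_or] at hx
  have hxk : |dualSum T m f k x / a k - μ| < δ := by simpa [hE, Real.dist_eq] using hx.1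
  have hxn : |dualSum T m f n x / a n - μ| < δ := by simpa [hE, Real.dist_eq] using hx.2
  have h1 : (μ - δ) * a k < dualSum T m f k x :=
    (lt_div_iff₀ hk0).1 (by linarith [(abs_lt.1 hxk).1])
  have h2 : dualSum T m f n x < (μ + δ) * a n :=
    (div_lt_iff₀ hn0).1 (by linarith [(abs_lt.1 hxn).2])
  have h3 : dualSum T m f k x ≤ dualSum T m f n x := dualSum_mono x hkn
  have hc1 : c + 1 ≠ 0 := by linarith
  have h4 : μ - δ = μ * 2 / (c + 1) := by rw [hδ]; field_simp; ring
  have h5 : μ + δ = c * (μ * 2 / (c + 1)) := by rw [hδ]; field_simp; ring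
  have h6 : 0 < μ * 2 / (c + 1) := div_pos (by linarith) (by linarith)
  rw [h4] at h1
  rw [h5] at h2
  refine le_of_mul_le_mul_left ?_ h6
  linarith

/-- Running maxima are nondecreasing, and they are equivalent to the original sequence because it is
asymptotically nondecreasing. Their increments serve as u. -/
lemma IsReturnSequence.exists_sum_nonneg [SigmaFinite m] (hcons : Conservative T m)
    (herg : Ergodic T m) {a : ℕ → ℝ} (ha : IsReturnSequence T m a) (hA : FinPos m A) :
    ∃ u : ℕ → ℝ, (∀ n, 0 ≤ u n) ∧
      IsReturnSequence T m (fun n => ∑ j ∈ Finset.range n, u j) := by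
  set α : ℕ → ℝ := fun n => a (n + 1) with hα
  have hα0 : ∀ n, 0 < α n := fun n => ha.1 _ (by omega)
  have hαtop : Tendsto α atTop atTop :=
    (ha.tendsto_atTop hcons herg hA).comp (tendsto_add_atTop_nat 1)
  set p : ℕ → ℝ := fun n => partialSups α n with hp
  have hαp : ∀ n, α n ≤ p n := fun n => le_partialSups α n
  have hpm : Monotone p := (partialSups α).monotone
  have hp0 : ∀ n, 0 < p n := fun n => (hα0 n).trans_le (hαp n)
  have hratio : Tendsto (fun n => α n / p n) atTop (𝓝 1) := by
    have hcle : ∀ c : ℝ, 1 < c → ∀ᶠ n in atTop, p n ≤ c * α n := by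
      intro c hc
      obtain ⟨N, hN⟩ := ha.eventually_le_mul hA hc
      -- The finitely many indices k ≤ N escape the comparison, but their maximum `p N` is
      -- eventually exceeded since α tends to infinity.
      filter_upwards [hαtop.eventually_ge_atTop (p N), eventually_ge_atTop N] with n hn hNn
      refine partialSups_le α n _ fun k hk => ?_
      rcases le_total k N with h | h
      · have h1 : α k ≤ p N := (hαp k).trans (hpm h)
        nlinarith [hα0 n]
      · exact hN _ _ (by omega) (by omega)
    rw [tendsto_order]
    refine ⟨fun b hb => ?_, fun b hb => Eventually.of_forall fun n =>
      ((div_le_one (hp0 n)).2 (hαp n)).trans_lt hb⟩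
    rcases le_or_gt b 0 with h0 | h0
    · exact Eventually.of_forall fun n => h0.trans_lt (div_pos (hα0 n) (hp0 n))
    · obtain ⟨b', hbb', hb'1⟩ := exists_between hb
      have hb'0 := h0.trans hbb'
      filter_upwards [hcle b'⁻¹ (one_lt_inv_iff₀.2 ⟨hb'0, hb'1⟩)] with n hn
      refine hbb'.trans_le ((le_div_iff₀ (hp0 n)).2 ?_)
      rwa [le_inv_mul_iff₀ hb'0] at hn
  set u : ℕ → ℝ := fun n => if n = 0 then p 0 else p n - p (n - 1) with hu
  have hsum : ∀ n, ∑ j ∈ Finset.range (n + 1), u j = p n := by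
    intro n
    induction n with
    | zero => simp [hu]
    | succ n ih =>
      rw [Finset.sum_range_succ, ih]
      simp [hu]
  refine ⟨u, fun n => ?_, ha.congr (fun n hn => ?_) ?_⟩
  · by_cases hn : n = 0
    · simp only [hu, hn, if_true]
      exact (hp0 0).le
    · simp only [hu, hn, if_false]
      exact sub_nonneg.2 (hpm (Nat.sub_le n 1))
  · obtain ⟨k, rfl⟩ := Nat.exists_eq_add_of_le' hn
    rw [hsum]
    exact hp0 k
  · rw [← tendsto_add_atTop_iff_nat 1]
    simpa only [hsum] using hratio

lemma tendsto_exp_neg_nhdsGT_zero :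
    Tendsto (fun s : ℝ => Real.exp (-s)) (𝓝[>] 0) (𝓝[<] 1) := by
  refine tendsto_nhdsWithin_iff.2 ⟨?_, ?_⟩
  · have h : Continuous fun s : ℝ => Real.exp (-s) := by fun_prop
    simpa using (h.tendsto 0).mono_left nhdsWithin_le_nhds
  · filter_upwards [self_mem_nhdsWithin] with s hs
    exact Real.exp_lt_one_iff.2 (neg_lt_zero.2 hs)

lemma exp_neg_mul_natCast (s : ℝ) (n : ℕ) : Real.exp (-s * n) = Real.exp (-s) ^ n := by
  rw [mul_comm, Real.exp_nat_mul]

lemma laplaceSum_eq_powSum (u : ℕ → ℝ) (s : ℝ) : laplaceSum u s = powSum u (Real.exp (-s)) := by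
  simp only [laplaceSum, powSum, exp_neg_mul_natCast]

end InfErg

end

/-! ### The main theorem -/

theorem mainTheorem8 {X : Type*} [MeasurableSpace X] (m : Measure X) [SigmaFinite m]
    (T : X → X) (hcons : Conservative T m) (herg : Ergodic T m)
    (hT : InfErg.WeaklyPDE T m) :
    -- the return sequence can be taken of the form `∑ j < n, u j` with `u ≥ 0`
    (∃ u : ℕ → ℝ, (∀ n, 0 ≤ u n) ∧
      InfErg.IsReturnSequence T m (fun n => ∑ j ∈ Finset.range n, u j)) ∧
    -- the asymptotic renewal equation, for every such choice of `u`
    (∀ u : ℕ → ℝ, (∀ n, 0 ≤ u n) →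
      InfErg.IsReturnSequence T m (fun n => ∑ j ∈ Finset.range n, u j) →
      ∀ A : Set X, InfErg.HasMinimalWanderingRate T m A →
        (∀ s : ℝ, 0 < s → Summable (fun n : ℕ => Real.exp (-s * (n : ℝ)) * u n)) ∧
        (fun s : ℝ => InfErg.returnLaplace T m A s) ~[𝓝[>] (0 : ℝ)]
          (fun s : ℝ => 1 / InfErg.laplaceSum u s)) ∧
    -- uniform sets have minimal wandering rate
    (∀ A : Set X, InfErg.IsUniformSet T m A → InfErg.HasMinimalWanderingRate T m A) := by
  refine ⟨?_, fun u _ hret A hA => ?_, fun A hA => hA.hasMinimalWanderingRate hcons herg⟩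
  · obtain ⟨a, ha⟩ := hT
    -- For m = 0 there is no set of positive measure to work on, but no function of positive
    -- integral either. Only positivity of the partial sums remains to be checked.
    by_cases hm : m = 0
    · subst hm
      have hL : ∀ f : X → ℝ, ¬ InfErg.L1Pos (0 : Measure X) f := fun f hf => by
        simpa using hf.2.2
      refine ⟨fun _ => 1, fun _ => zero_le_one, fun n hn => ?_, fun f hf => absurd hf (hL f),
        fun f hf => absurd hf (hL f)⟩
      simpa using Nat.pos_of_ne_zero (by omega)
    · obtain ⟨A, hAm, -, hA0, hAt⟩ := Measure.exists_subset_measure_lt_top (μ := m)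
        MeasurableSet.univ (Measure.measure_univ_pos.2 hm)
      exact ha.exists_sum_nonneg hcons herg (A := A) ⟨hAm, hA0, hAt⟩
  · have hsum : ∀ z : ℝ, 0 < z → z < 1 →
        Summable fun n : ℕ => z ^ n * ∑ j ∈ Finset.range (n + 1), u j := fun z h0 h1 =>
      hret.summable herg hA.1 h0 h1
    have hexp : ∀ s : ℝ, 0 < s → Real.exp (-s) < 1 := fun s hs =>
      Real.exp_lt_one_iff.2 (neg_lt_zero.2 hs)
    refine ⟨fun s hs => ?_, isEquivalent_of_tendsto_one ?_⟩
    · simp only [InfErg.exp_neg_mul_natCast]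
      exact (InfErg.hasSum_pow_mul_of_partialSum (hsum _ (Real.exp_pos _) (hexp s hs))).summable
    -- With z = exp(-s), summation by parts turns (1 - z) Σ z^n a_{n+1} into Σ z^n u_n, so the limit
    -- 1 is that of c_A(s) u_T(s).
    · refine ((hret.tendsto_mul_powSum_returnTail hcons herg hA).comp
        InfErg.tendsto_exp_neg_nhdsGT_zero).congr' ?_
      filter_upwards [self_mem_nhdsWithin] with s hs
      rw [Pi.div_apply, div_div_eq_mul_div, div_one, InfErg.laplaceSum_eq_powSum,
        InfErg.returnLaplace_eq_powSum hcons herg.measurable hA.1 hs, Function.comp_apply,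
        InfErg.powSum_eq_of_partialSum (hsum _ (Real.exp_pos _) (hexp s hs)), mul_comm]
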